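/- Let $M\ge 1$, $L\ge 1$, $N=2M+1$, let $\omega\in\mathbb C$ be a primitive $N$th root of unity and $q=\omega^{M+1}$ (so $q^2=\omega$, $q^N=1$). On $\mathbb C^N$ (vectors $v=(v_k)_{k\in\mathbb Z_N}$) let $(Zv)_k=\omega^kv_k$, $(Xv)_k=v_{k-1}$, $Y=ZX$. Write $(y;s)_n=\prod_{i=0}^{n-1}(1-ys^i)$. For $0\le j\le L-1$ (indices cyclic mod $L$) let $h_j=[a_j:b_j:c_j:d_j]$ with $a_j,b_j,c_j,d_j\in\mathbb C\setminus\{0\}$, let $$L_{h_j}(x)=\begin{pmatrix}a_jY& xb_jX\\ xc_jZ& d_j\end{pmatrix},\qquad T(x)=(d_0\cdots d_{L-1})^{-1}\,\mathrm{tr}_{\mathbb C^2}\bigl(L_{h_0}(x)\otimes\cdots\otimes L_{h_{L-1}}(x)\bigr)$$ (matrix product in the auxiliary space $\mathbb C^2$, tensor product in the quantum space $\bigotimes^L\mathbb C^N$). The spectral curve $\mathcal C_{\vec h}$ is the set of $(x,\xi_0,\dots,\xi_{L-1})$ with $\xi_j^N(\xi_{j+1}^Nx^Nc_j^N-d_j^N)=(-1)^N(\xi_{j+1}^Na_j^N-x^Nb_j^N)$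 for all $j$. Assume that it degenerates into rational curves: there are $r_j$ with $r_{j+1}^2=\frac{b_jd_j}{a_jc_j}$ such that $(x,r_0q^l,\dots,r_{L-1}q^l)\in\mathcal C_{\vec h}$ for all $x\in\mathbb C$, $l\in\mathbb Z_N$. Put $c_j^*=d_j^{-1}c_jr_{j+1}$ and $$\Delta_-(x,l)=\prod_j(1-xc_j^*q^l),\qquad \Delta_+(x,l)=\prod_j\frac{1-x^2c_j^{*2}}{1-xc_j^*q^{-l}} .$$ Let $|x,l\rangle=\bigotimes_j|p_j\rangle$ be the Baxter vacuum state at $\xi_j=r_jq^l$, that is, $\langle0|p_j\rangle=1$ and $\frac{\langle m|p_j\rangle}{\langle m-1|p_j\rangle}=\frac{\xi_{j+1}a_j\omega^m-xb_j}{-\xi_j(\xi_{j+1}xc_j\omega^m-d_j)}$. Its components are, for $0\le k_j\le N-1$, $$\langle \mathbf k|x,l\rangle=q^{\sum_jk_j^2}\prod_{j}\Bigl(\frac{q\,a_jr_{j+1}}{d_jr_j}\Bigr)^{k_j}\frac{(xc_j^*q^{-l-2};\omega^{-1})_{k_j}}{(xc_j^*q^{l+2};\omega)_{k_j}}$$ (the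 first factor in the product is $1$ in the normalization $qa_jr_{j+1}=d_jr_j$). Define $$f^e(x,2n)=\prod_j\frac{(xc^*_j;\omega^{-1})_{n+1}}{(xc^*_j;\omega)_{n+1}},\quad f^o(x,2n+1)=\prod_j\frac{(xc^*_jq^{-1};\omega^{-1})_{n+1}}{(xc^*_jq;\omega)_{n+1}},\quad u(x)=\prod_j(1-x^Nc_j^{*N})(xc_j^*q;q^2)_M,$$ $$|x\rangle_l^e=\sum_{n=0}^{N-1}|x,2n\rangle f^e(x,2n)\omega^{ln},\qquad |x\rangle_l^o=\sum_{n=0}^{N-1}|x,2n+1\rangle f^o(x,2n+1)\omega^{ln},$$ $$|x\rangle_l^+=|x\rangle_l^e\,q^{-l}u(qx)+|x\rangle_l^o\,u(x).$$ Then, as identities of rational functions of $x$ (valid wherever $x^Nc_j^{*N}\ne1$ for all $j$), for all $l\in\mathbb Z_N$: (i) $|x\rangle_l^e\,u(qx)=|x\rangle_l^o\,q^lu(x)$, and $|x\rangle_l^+=2q^{-l}|x\rangle_l^e\,u(qx)=2|x\rangle_l^o\,u(x)$. (ii) $q^{-l}T(x)|x\rangle_l^+=|q^{-1}x\rangle_l^+\Delta_-(x,-1)+|qx\rangle_l^+\Delta_+(x,0)$.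 (iii) Let $\langle\varphi|\ne0$ be a common eigenvector of all $T(x)$, $\langle\varphi|T(x)=\Lambda(x)\langle\varphi|$. Then $\Lambda(x)$ and, for every $l\in\mathbb Z_N$, $Q_l^+(x)=\langle\varphi|x\rangle_l^+$ are polynomials, with $$\deg Q_l^+\le(3M+1)L,\qquad \deg\Lambda\le2\lfloor L/2\rfloor,\qquad \Lambda(-x)=\Lambda(x);$$ there is $l\in\mathbb Z_N$ with $\Lambda(0)=q^{2l}+1$, and $\Lambda(0)=q^{2l}+1$ holds for every $l$ with $Q_l^+\ne0$; and for every $l$ $$q^{-l}\Lambda(x)Q_l^+(x)=\prod_{j=0}^{L-1}(1-xc_j^*q^{-1})\,Q_l^+(xq^{-1})+\prod_{j=0}^{L-1}(1+xc_j^*)\,Q_l^+(xq).$$ Furthermore, for $0\le m\le M$, $Q_m^+(x)$ and $Q_{N-m}^+(x)$ lie in $x^m\prod_{j=0}^{L-1}(1-x^Nc_j^{*N})\,\mathbb C[x]$. -/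

import Mathlib

open Polynomial Matrix

noncomputable section

namespace BaxterTQ

/-- Homogeneous coordinates `[a : b : c : d]` of the parameter of an `L`-operator. -/
structure LParam where
  a : ℂ
  b : ℂ
  c : ℂ
  d : ℂ

/-- The `s`-shifted factorial `(y ; s)_n = (1 - y) (1 - y s) ⋯ (1 - y s ^ (n - 1))`. -/
def shiftedFactorial (y s : ℂ) (n : ℕ) : ℂ :=
  ∏ i ∈ Finset.range n, (1 - y * s ^ i)

/-- The matrix of `Z` on `ℂ^N`, `(Z v)_k = ω ^ k * v_k`. -/
def weylZ (N : ℕ) (ω : ℂ) : Matrix (ZMod N) (ZMod N) ℂ :=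
  Matrix.diagonal fun k => ω ^ k.val

/-- The matrix of `X` on `ℂ^N`, `(X v)_k = v_{k - 1}`. -/
def weylX (N : ℕ) : Matrix (ZMod N) (ZMod N) ℂ :=
  Matrix.of fun k k' => if k' = k - 1 then 1 else 0

/-- The matrix of `Y = Z X` on `ℂ^N`, `(Y v)_k = ω ^ k * v_{k - 1}`. -/
def weylY (N : ℕ) [NeZero N] (ω : ℂ) : Matrix (ZMod N) (ZMod N) ℂ :=
  weylZ N ω * weylX N

/-- The `(k, k')` matrix element (in the quantum space `ℂ^N`) of the `L`-operator
`!![a Y, x b X; x c Z, d]`: a `2 × 2` matrix on the auxiliary space. -/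
def lOp (N : ℕ) [NeZero N] (ω : ℂ) (h : LParam) (x : ℂ) (k k' : ZMod N) :
    Matrix (Fin 2) (Fin 2) ℂ :=
  !![h.a * weylY N ω k k', x * h.b * weylX N k k';
     x * h.c * weylZ N ω k k', h.d * (1 : Matrix (ZMod N) (ZMod N) ℂ) k k']

/-- The quantum space `⊗^L ℂ^N`, a vector being given by its components `⟨k|v⟩` in the standard
basis `|k⟩ = |k_0⟩ ⊗ ⋯ ⊗ |k_{L-1}⟩`. -/
abbrev QSpace (N L : ℕ) : Type := (Fin L → ZMod N) → ℂ

/-- The transfer matrix `tr_aux (L_{h_0}(x) ⊗ ⋯ ⊗ L_{h_{L-1}}(x))`: tensor product in the quantum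
spaces (so that matrix elements multiply) and ordered matrix product in the auxiliary space. -/
def transferMatrix (N L : ℕ) [NeZero N] (ω : ℂ) (h : Fin L → LParam) (x : ℂ) :
    Matrix (Fin L → ZMod N) (Fin L → ZMod N) ℂ :=
  Matrix.of fun k k' =>
    Matrix.trace (List.ofFn fun j => lOp N ω (h j) x (k j) (k' j)).prod

/-- The transfer matrix divided by `d_0 ⋯ d_{L-1}`. -/
def normTransfer (N L : ℕ) [NeZero N] (ω : ℂ) (h : Fin L → LParam) (x : ℂ) :
    Matrix (Fin L → ZMod N) (Fin L → ZMod N) ℂ :=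
  (∏ j, (h j).d)⁻¹ • transferMatrix N L ω h x

/-- The affine spectral curve in the coordinates `(x, ξ_0, …, ξ_{L-1})`, denominators cleared;
the index `j + 1` is read cyclically. -/
def spectralCurve (N L : ℕ) [NeZero L] (h : Fin L → LParam) : Set (ℂ × (Fin L → ℂ)) :=
  {p | ∀ j, p.2 j ^ N * (p.2 (j + 1) ^ N * p.1 ^ N * (h j).c ^ N - (h j).d ^ N) =
    (-1) ^ N * (p.2 (j + 1) ^ N * (h j).a ^ N - p.1 ^ N * (h j).b ^ N)}

/-- The Baxter vacuum state `|p_0⟩ ⊗ ⋯ ⊗ |p_{L-1}⟩` at the point `p = (x, ξ)`, where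
`⟨0|p_j⟩ = 1` and
`⟨m|p_j⟩ / ⟨m-1|p_j⟩ = (ξ_{j+1} a_j ω^m - x b_j) / (-ξ_j (ξ_{j+1} x c_j ω^m - d_j))`. -/
def vacuum (N L : ℕ) [NeZero L] (ω : ℂ) (h : Fin L → LParam) (x : ℂ) (ξ : Fin L → ℂ) :
    QSpace N L := fun k =>
  ∏ j, ∏ i ∈ Finset.range (k j).val,
    (ξ (j + 1) * (h j).a * ω ^ (i + 1) - x * (h j).b) /
      (-ξ j * (ξ (j + 1) * x * (h j).c * ω ^ (i + 1) - (h j).d))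

/-- The point of the rational curve over `x` in the component `l`: `ξ_j = r_j q ^ l`. -/
def sheet {L : ℕ} (q : ℂ) (r : Fin L → ℂ) (l : ℤ) : Fin L → ℂ := fun j => r j * q ^ l

/-- `|x, l⟩`, the Baxter vacuum state on the rational curve (`l` is read modulo `N`). -/
def vac (N L : ℕ) [NeZero L] (ω q : ℂ) (h : Fin L → LParam) (r : Fin L → ℂ) (l : ℤ) (x : ℂ) :
    QSpace N L :=
  vacuum N L ω h x (sheet q r l)

/-- `c*_j = d_j⁻¹ c_j r_{j+1}`. -/
def cstar {L : ℕ} [NeZero L] (h : Fin L → LParam) (r : Fin L → ℂ) (j : Fin L) : ℂ :=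
  (h j).d⁻¹ * (h j).c * r (j + 1)

/-- The value `f^e(x, 2n)`, where `cs j` stands for `c*_j`. -/
def fEven {L : ℕ} (ω : ℂ) (cs : Fin L → ℂ) (x : ℂ) (n : ℕ) : ℂ :=
  ∏ j, shiftedFactorial (x * cs j) ω⁻¹ (n + 1) / shiftedFactorial (x * cs j) ω (n + 1)

/-- The value `f^o(x, 2n + 1)`. -/
def fOdd {L : ℕ} (ω q : ℂ) (cs : Fin L → ℂ) (x : ℂ) (n : ℕ) : ℂ :=
  ∏ j, shiftedFactorial (x * cs j * q⁻¹) ω⁻¹ (n + 1) / shiftedFactorial (x * cs j * q) ω (n + 1)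

/-- `u(x) = ∏_j (1 - x^N c*_j^N) (x c*_j q ; q²)_M`, with `N = 2M + 1`. -/
def uFun {L : ℕ} (M : ℕ) (q : ℂ) (cs : Fin L → ℂ) (x : ℂ) : ℂ :=
  ∏ j, (1 - x ^ (2 * M + 1) * cs j ^ (2 * M + 1)) * shiftedFactorial (x * cs j * q) (q ^ 2) M

/-- `|x⟩_l^e = ∑_n |x, 2n⟩ f^e(x, 2n) ω^{l n}`. -/
def ketEven (N L : ℕ) [NeZero L] (ω q : ℂ) (h : Fin L → LParam) (r : Fin L → ℂ) (l : ℤ) (x : ℂ) :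
    QSpace N L :=
  ∑ n ∈ Finset.range N,
    (fEven ω (cstar h r) x n * ω ^ (l * (n : ℤ))) • vac N L ω q h r (2 * (n : ℤ)) x

/-- `|x⟩_l^o = ∑_n |x, 2n + 1⟩ f^o(x, 2n + 1) ω^{l n}`. -/
def ketOdd (N L : ℕ) [NeZero L] (ω q : ℂ) (h : Fin L → LParam) (r : Fin L → ℂ) (l : ℤ) (x : ℂ) :
    QSpace N L :=
  ∑ n ∈ Finset.range N,
    (fOdd ω q (cstar h r) x n * ω ^ (l * (n : ℤ))) • vac N L ω q h r (2 * (n : ℤ) + 1) x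

/-- `|x⟩_l^+ = |x⟩_l^e q^{-l} u(qx) + |x⟩_l^o u(x)`, with `N = 2M + 1`. -/
def ketPlus (M L : ℕ) [NeZero L] (ω q : ℂ) (h : Fin L → LParam) (r : Fin L → ℂ) (l : ℤ) (x : ℂ) :
    QSpace (2 * M + 1) L :=
  (q ^ (-l) * uFun M q (cstar h r) (q * x)) • ketEven (2 * M + 1) L ω q h r l x +
    uFun M q (cstar h r) x • ketOdd (2 * M + 1) L ω q h r l x

/-- `Δ_-(x, l) = ∏_j (1 - x c*_j q^l)`. -/
def deltaMinus {L : ℕ} (q : ℂ) (cs : Fin L → ℂ) (x : ℂ) (l : ℤ) : ℂ :=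
  ∏ j, (1 - x * cs j * q ^ l)

/-- `Δ_+(x, l) = ∏_j (1 - x² c*_j²) / (1 - x c*_j q^{-l})`. -/
def deltaPlus {L : ℕ} (q : ℂ) (cs : Fin L → ℂ) (x : ℂ) (l : ℤ) : ℂ :=
  ∏ j, (1 - x ^ 2 * cs j ^ 2) / (1 - x * cs j * q ^ (-l))

/-- The complement of the finite set `{x | x^N c*_j^N = 1 for some j}`, which contains all the
poles of the rational functions above. -/
def regularPoints {L : ℕ} (N : ℕ) (cs : Fin L → ℂ) : Set ℂ :=
  {x | ∀ j, x ^ N * cs j ^ N ≠ 1}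

end BaxterTQ

end

/-!
Write `y_j = x c*_j` and `N = 2 M + 1`. On a rational component of the spectral curve the ratios
`⟨m|p_j⟩ / ⟨m - 1|p_j⟩` depend on `x` through `y_j` only, and the components of the vacuum state
are quotients of shifted factorials in `y_j`. After multiplication by `f^e` and `f^o` they combine
into
`⟨k|x⟩_l^e = ∏_j q^{k_j²} κ_j^{k_j} · ∑_n ω^{ln} ∏_j F(y_j, n + 1 + k_j)`,
`F(y, m) = (y ; ω⁻¹)_m / (y ; ω)_m`,
and a similar formula for the odd vector, where `κ_j = q a_j r_{j+1} / (d_j r_j)` satisfies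
`κ_j^N = 1` by the equations of the curve over `x = 0`, and `F(y, ·)` is `N`-periodic
(`Degenerate.ketEven_apply`, `Degenerate.ketOdd_apply`). Everything follows from this form.

* Since `q = ω^{M+1}`, the odd ratio is the even one advanced by `M + 1`, half a period; shifting
  the summation index proves (i) (`oddRatio_eq_evenRatio`, `Degenerate.ketEven_eq_ketOdd`).
* On a product vector the transfer matrix is the trace of a product of `2 × 2` matrices, one per
  site. For each summand of the even vector a cyclic gauge transformation by unipotent matrices
  makes all of them lower triangular, so that the trace is the sum of two products
  (`trace_prod_ofFn_of_gaugeTriangular`, `Degenerate.gaugeTriangular_lOpVec`). They are components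
  of the odd vectors at `q x` and `q⁻¹ x`; together with (i) this is (ii)
  (`Degenerate.normTransfer_mulVec_ketEven`, `Degenerate.normTransfer_mulVec_ketPlus`).
* The reflection `F(y, N + 1 - m) = F(y, m)` shows that `(y ω ; ω)_M F(y, m)` is a polynomial of
  degree at most `M` for every `m`. So `Q_l^+` is a polynomial divisible by
  `∏_j (1 - x^N c*_j^N)`, of degree at most `N L + M L`
  (`exists_polynomial_evenRatio`, `Degenerate.exists_polynomial_dotProduct_ketPlus`).
* The eigenvalue is a polynomial of degree at most `L` because the transfer matrix is, and it is
  even because conjugation by a Pauli matrix in the auxiliary space changes the sign of `x`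
  (`exists_polynomial_eigenvalue`).
* At `x = 0` the transfer matrix is `1` plus a multiple of `⊗ Y`, which is a translation of order
  `N` in a rescaled basis; the vector `|x⟩_l^+` is an eigenvector of it with eigenvalue `ω^l`. Hence
  `Λ(0) - 1` is an `N`th root of unity, equal to `ω^l` as soon as `Q_l^+ ≠ 0`
  (`Degenerate.exists_eigenvalue_zero`, `Degenerate.eigenvalue_zero_mul`).
* If `s` is the order of vanishing of `Q_l^+` at `0`, the lowest coefficient of the `TQ` relation
  gives `q^{-l} Λ(0) = q^s + q^{-s}`, so `s ≡ ± l` modulo `N`, which yields the factor `x^m`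
  (`exists_order_of_tq`, `Degenerate.X_pow_dvd`).
-/

noncomputable section

namespace BaxterTQ

/-! ### Shifted factorials and their ratios -/

lemma shiftedFactorial_zero (y s : ℂ) : shiftedFactorial y s 0 = 1 := by
  simp [shiftedFactorial]

lemma shiftedFactorial_add (y s : ℂ) (m n : ℕ) :
    shiftedFactorial y s (m + n) = shiftedFactorial y s m * shiftedFactorial (y * s ^ m) s n := by
  simp only [shiftedFactorial, Finset.prod_range_add, pow_add, mul_assoc]

lemma shiftedFactorial_succ (y s : ℂ) (n : ℕ) :
    shiftedFactorial y s (n + 1) = shiftedFactorial y s n * (1 - y * s ^ n) :=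
  Finset.prod_range_succ _ _

lemma shiftedFactorial_succ' (y s : ℂ) (n : ℕ) :
    shiftedFactorial y s (n + 1) = (1 - y) * shiftedFactorial (y * s) s n := by
  rw [add_comm, shiftedFactorial_add]
  simp [shiftedFactorial]

/-- Reading the factors of `(y s⁻¹ ; s⁻¹)_n` backwards. -/
lemma shiftedFactorial_inv {s : ℂ} (hs : s ≠ 0) (y : ℂ) (n : ℕ) :
    shiftedFactorial (y * s⁻¹) s⁻¹ n = shiftedFactorial (y * s⁻¹ ^ n) s n := by
  unfold shiftedFactorial
  rw [← Finset.prod_range_reflect]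
  refine Finset.prod_congr rfl fun i hi => ?_
  have hi' := Finset.mem_range.1 hi
  obtain ⟨k, rfl⟩ : ∃ k, n = k + i + 1 := ⟨n - 1 - i, by omega⟩
  have : k + i + 1 - 1 - i = k := by omega
  have h1 : s⁻¹ ^ (k + i + 1) * s ^ i = s⁻¹ ^ (k + 1) := by
    rw [add_right_comm, pow_add _ (k + 1), mul_assoc, ← mul_pow, inv_mul_cancel₀ hs, one_pow,
      mul_one]
  rw [this, mul_assoc, mul_assoc, h1, pow_succ']

section RootOfUnity

variable {N : ℕ} {ω y : ℂ}

lemma one_sub_mul_pow_ne_zero (hω : ω ^ N = 1) (hy : y ^ N ≠ 1) (i : ℕ) :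
    1 - y * ω ^ i ≠ 0 := by
  intro h0
  apply hy
  have h1 : y * ω ^ i = 1 := (sub_eq_zero.1 h0).symm
  calc y ^ N = (y * ω ^ i) ^ N := by rw [mul_pow, ← pow_mul, mul_comm i, pow_mul, hω]; simp
    _ = 1 := by rw [h1, one_pow]

lemma shiftedFactorial_ne_zero (hω : ω ^ N = 1) (hy : y ^ N ≠ 1) (n : ℕ) :
    shiftedFactorial y ω n ≠ 0 :=
  Finset.prod_ne_zero_iff.2 fun i _ => one_sub_mul_pow_ne_zero hω hy i

lemma shiftedFactorial_full_inv (hN : N ≠ 0) (hω : ω ^ N = 1) (hy : y ^ N ≠ 1) :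
    shiftedFactorial y ω⁻¹ N = shiftedFactorial y ω N := by
  have h0 : ω ≠ 0 := by rintro rfl; simp [hN] at hω
  have h1 := shiftedFactorial_inv h0 (y * ω) N
  rw [mul_inv_cancel_right₀ h0, inv_pow, hω, inv_one, mul_one] at h1
  have h2 := shiftedFactorial_succ y ω N
  rw [shiftedFactorial_succ', hω, mul_one, mul_comm] at h2
  have h3 : 1 - y ≠ 0 := by simpa using one_sub_mul_pow_ne_zero hω hy 0
  rw [h1]
  exact mul_right_cancel₀ h3 h2

/-- The ratio `(y ; ω⁻¹)_m / (y ; ω)_m` from which the components of the even vectors are built. -/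
def evenRatio (ω y : ℂ) (m : ℕ) : ℂ :=
  shiftedFactorial y ω⁻¹ m / shiftedFactorial y ω m

/-- The ratio `(y q⁻¹ ; ω⁻¹)_m / (y q ; ω)_m` from which the components of the odd vectors are
built. -/
def oddRatio (ω q y : ℂ) (m : ℕ) : ℂ :=
  shiftedFactorial (y * q⁻¹) ω⁻¹ m / shiftedFactorial (y * q) ω m

lemma evenRatio_periodic (hN : N ≠ 0) (hω : ω ^ N = 1) (hy : y ^ N ≠ 1) :
    Function.Periodic (evenRatio ω y) N := by
  intro m
  have h1 := shiftedFactorial_ne_zero hω hy N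
  have h2 := shiftedFactorial_ne_zero hω hy m
  rw [evenRatio, evenRatio, add_comm, shiftedFactorial_add, shiftedFactorial_add, inv_pow, hω,
    shiftedFactorial_full_inv hN hω hy]
  simp only [inv_one, mul_one]
  field_simp

lemma evenRatio_succ (ω y : ℂ) (m : ℕ) :
    evenRatio ω y (m + 1) = evenRatio ω y m * ((1 - y * ω⁻¹ ^ m) / (1 - y * ω ^ m)) := by
  simp only [evenRatio, shiftedFactorial_succ]
  rw [mul_div_mul_comm]

lemma evenRatio_zero (ω y : ℂ) : evenRatio ω y 0 = 1 := by
  simp [evenRatio, shiftedFactorial_zero]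

lemma evenRatio_succ' (hω : ω ^ N = 1) (hy : y ^ N ≠ 1) (m : ℕ) :
    evenRatio ω y (m + 1) =
      shiftedFactorial (y * ω⁻¹) ω⁻¹ m / shiftedFactorial (y * ω) ω m := by
  have h3 : 1 - y ≠ 0 := by simpa using one_sub_mul_pow_ne_zero hω hy 0
  rw [evenRatio, shiftedFactorial_succ', shiftedFactorial_succ', mul_div_mul_left _ _ h3]

/-- The substitution `i ↦ N - i` in the products, whose total over a period is `1`. -/
lemma evenRatio_reflect (hN : N ≠ 0) (hω : ω ^ N = 1) (hy : y ^ N ≠ 1) (m : ℕ) (hm : m ≤ N) :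
    evenRatio ω y (N + 1 - m) = evenRatio ω y m := by
  have h0 : ω ≠ 0 := by rintro rfl; simp [hN] at hω
  have hω' : ω⁻¹ ^ N = 1 := by rw [inv_pow, hω, inv_one]
  induction m with
  | zero =>
    rw [Nat.sub_zero, add_comm, evenRatio_periodic hN hω hy, ← zero_add 1,
      evenRatio_succ' hω hy, shiftedFactorial_zero, shiftedFactorial_zero, evenRatio_zero, div_one]
  | succ m ih =>
    have ih := ih (by omega)
    obtain ⟨k, rfl⟩ : ∃ k, N = k + m := ⟨N - m, by omega⟩
    have e1 : k + m + 1 - (m + 1) = k := by omega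
    have e2 : k + m + 1 - m = k + 1 := by omega
    rw [e2, evenRatio_succ] at ih
    rw [e1, evenRatio_succ, ← ih]
    have e3 : ω ^ k = ω⁻¹ ^ m := by
      rw [inv_pow]
      exact eq_inv_of_mul_eq_one_left (by rw [← pow_add, hω])
    have e4 : ω⁻¹ ^ k = ω ^ m := by rw [inv_pow, e3, inv_pow, inv_inv]
    rw [e3, e4]
    have h1 := one_sub_mul_pow_ne_zero hω hy m
    have h2 := one_sub_mul_pow_ne_zero hω' hy m
    generalize ω⁻¹ ^ m = w at h2 ⊢
    field_simp

end RootOfUnity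

section HalfPeriod

variable {M : ℕ} {ω q y : ℂ}

/-- Multiplying by `q` amounts to advancing by `M + 1` in the `ω`-products, half a period. -/
lemma oddRatio_eq_evenRatio (hω : ω ^ (2 * M + 1) = 1) (hq : q = ω ^ (M + 1))
    (hy : y ^ (2 * M + 1) ≠ 1) (m : ℕ) :
    shiftedFactorial (y * q) ω M * oddRatio ω q y m =
      shiftedFactorial (y * ω) ω M * evenRatio ω y (m + (M + 1)) := by
  have h0 : ω ≠ 0 := by rintro rfl; simp at hω
  have hqM : ω⁻¹ ^ M = q := by
    rw [inv_pow, hq]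
    refine (eq_inv_of_mul_eq_one_left ?_).symm
    rw [← pow_add, ← hω]
    congr 1; ring
  have hyq : (y * q) ^ (2 * M + 1) ≠ 1 := by
    rwa [mul_pow, hq, ← pow_mul, mul_comm (M + 1), pow_mul, hω, one_pow, mul_one]
  have hyω : (y * ω) ^ (2 * M + 1) ≠ 1 := by rwa [mul_pow, hω, mul_one]
  have h1 : 1 - y ≠ 0 := by simpa using one_sub_mul_pow_ne_zero hω hy 0
  have h2 := shiftedFactorial_ne_zero hω hyω M
  have h3 := shiftedFactorial_ne_zero hω hyq m
  rw [evenRatio, add_comm m, shiftedFactorial_add _ _ (M + 1), shiftedFactorial_add _ _ (M + 1),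
    inv_pow, ← hq,
    shiftedFactorial_succ', shiftedFactorial_succ', shiftedFactorial_inv h0, hqM, oddRatio]
  field_simp

end HalfPeriod

/-- Up to the factor `(y ω ; ω)_M` the even ratio is a polynomial in `y` of degree at most `M`:
by reflection only the first half of a period has to be considered, where the denominator
divides this factor. -/
lemma exists_polynomial_evenRatio {M : ℕ} {ω : ℂ} (hω : ω ^ (2 * M + 1) = 1) (m : ℕ) :
    ∃ p : ℂ[X], p.natDegree ≤ M ∧ ∀ y : ℂ, y ^ (2 * M + 1) ≠ 1 →
      p.eval y = shiftedFactorial (y * ω) ω M * evenRatio ω y m := by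
  have half : ∀ s ≤ M, ∃ p : ℂ[X], p.natDegree ≤ M ∧ ∀ y : ℂ, y ^ (2 * M + 1) ≠ 1 →
      p.eval y = shiftedFactorial (y * ω) ω M * evenRatio ω y (s + 1) := by
    intro s hs
    obtain ⟨t, rfl⟩ : ∃ t, M = s + t := ⟨M - s, by omega⟩
    refine ⟨(∏ i ∈ Finset.range s, (1 - C (ω⁻¹ * ω⁻¹ ^ i) * X)) *
      ∏ i ∈ Finset.range t, (1 - C (ω * ω ^ s * ω ^ i) * X), ?_, ?_⟩
    · have hlin : ∀ c : ℂ, (1 - C c * X).natDegree ≤ 1 := fun c => by compute_degree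
      refine natDegree_mul_le_of_le ?_ ?_
      · refine (natDegree_prod_le _ _).trans ((Finset.sum_le_card_nsmul _ _ 1 ?_).trans (by simp))
        exact fun i _ => hlin _
      · refine (natDegree_prod_le _ _).trans ((Finset.sum_le_card_nsmul _ _ 1 ?_).trans (by simp))
        exact fun i _ => hlin _
    · intro y hy
      have hyω : (y * ω) ^ (2 * (s + t) + 1) ≠ 1 := by rwa [mul_pow, hω, mul_one]
      have h2 := shiftedFactorial_ne_zero hω hyω s
      rw [evenRatio_succ' hω hy, shiftedFactorial_add, mul_right_comm, mul_div_cancel₀ _ h2]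
      simp only [eval_mul, eval_prod, eval_sub, eval_one, eval_C, eval_X, shiftedFactorial]
      congr 1 <;> exact Finset.prod_congr rfl fun i _ => by ring
  have hper : ∀ y : ℂ, y ^ (2 * M + 1) ≠ 1 →
      evenRatio ω y (m % (2 * M + 1)) = evenRatio ω y m := fun y hy =>
    (evenRatio_periodic (by omega) hω hy).map_mod_nat m
  have hlt : m % (2 * M + 1) < 2 * M + 1 := Nat.mod_lt _ (by omega)
  have hrefl := fun y (hy : y ^ (2 * M + 1) ≠ 1) => evenRatio_reflect (by omega) hω hy _ hlt.le
  generalize m % (2 * M + 1) = m' at hper hlt hrefl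
  by_cases h1 : m' ∈ Set.Icc 1 (M + 1)
  · obtain ⟨p, hp, hp'⟩ := half (m' - 1) (by have := h1.2; omega)
    refine ⟨p, hp, fun y hy => ?_⟩
    rw [hp' y hy, Nat.sub_add_cancel h1.1, hper y hy]
  · rcases Nat.eq_zero_or_pos m' with h0 | h0
    · obtain ⟨p, hp, hp'⟩ := half 0 (by omega)
      refine ⟨p, hp, fun y hy => ?_⟩
      have := hrefl y hy
      rw [h0, Nat.sub_zero, add_comm, evenRatio_periodic (by omega) hω hy] at this
      rw [hp' y hy, ← hper y hy, h0, zero_add, this]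
    · have h2 : M + 1 < m' := by
        by_contra hcon
        exact h1 ⟨h0, by omega⟩
      obtain ⟨p, hp, hp'⟩ := half (2 * M + 1 - m') (by omega)
      refine ⟨p, hp, fun y hy => ?_⟩
      have e : 2 * M + 1 - m' + 1 = 2 * M + 1 + 1 - m' := by omega
      rw [hp' y hy, e, hrefl y hy, hper y hy]

/-! ### Sums over a period -/

lemma sum_range_periodic_add {g : ℕ → ℂ} {N : ℕ} (hg : Function.Periodic g N) (s : ℕ) :
    ∑ n ∈ Finset.range N, g (n + s) = ∑ n ∈ Finset.range N, g n := by
  induction s with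
  | zero => rfl
  | succ s ih =>
    rw [← ih]
    have h1 := Finset.sum_range_succ (fun n => g (n + s)) N
    rw [Finset.sum_range_succ', add_comm N s, hg s, zero_add] at h1
    simpa [add_right_comm, add_assoc] using add_right_cancel h1

/-- For a periodic sequence, the representative in `{0, …, N - 1}` may be taken before or after
adding one. -/
lemma periodic_val_sub_one {α : Type*} {N : ℕ} [NeZero N] {g : ℕ → α}
    (hg : Function.Periodic g N) (k : ZMod N) : g ((k - 1).val + 1) = g k.val := by
  have : ((k - 1).val + 1) % N = k.val := by
    have h1 : (((k - 1).val + 1 : ℕ) : ZMod N) = k := by simp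
    rw [← ZMod.val_natCast, h1]
  rw [← hg.map_mod_nat, this]

/-! ### Vacuum states and their sums -/

/-- The sum `∑_n tⁿ ∏_j g_j(n + 1 + k_j)` over one period. -/
def twistedSum {L : ℕ} (N : ℕ) (t : ℂ) (g : Fin L → ℕ → ℂ) (k : Fin L → ℕ) : ℂ :=
  ∑ n ∈ Finset.range N, t ^ n * ∏ j, g j (n + 1 + k j)

lemma twistedSum_shift {L N : ℕ} {t : ℂ} (ht : t ^ N = 1) {g : Fin L → ℕ → ℂ}
    (hg : ∀ j, Function.Periodic (g j) N) (s : ℕ) (k : Fin L → ℕ) :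
    t ^ s * twistedSum N t (fun j m => g j (m + s)) k = twistedSum N t g k := by
  have hper : Function.Periodic (fun n => t ^ n * ∏ j, g j (n + 1 + k j)) N := by
    intro n
    have : ∀ j, g j (n + N + 1 + k j) = g j (n + 1 + k j) := fun j => by
      rw [← hg j (n + 1 + k j)]; congr 1; ring
    simp only [this, pow_add, ht, mul_one]
  rw [twistedSum, twistedSum, ← sum_range_periodic_add hper s, Finset.mul_sum]
  refine Finset.sum_congr rfl fun n _ => ?_
  rw [pow_add, ← mul_assoc, mul_comm (t ^ s)]
  congr 1
  exact Finset.prod_congr rfl fun j _ => by congr 1; ring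

/-- The constant `q a_j r_{j+1} / (d_j r_j)`, an `N`th root of unity on degenerate curves. -/
def kappa {L : ℕ} [NeZero L] (q : ℂ) (h : Fin L → LParam) (r : Fin L → ℂ) (j : Fin L) : ℂ :=
  q * (h j).a * r (j + 1) / ((h j).d * r j)

/-- The factor `q^{k²} κ^k` of the components of the vacuum state that does not depend on the
spectral parameter. -/
def siteWeight (q κ : ℂ) (k : ℕ) : ℂ := q ^ k ^ 2 * κ ^ k

lemma siteWeight_succ (q κ : ℂ) (k : ℕ) :
    siteWeight q κ (k + 1) = siteWeight q κ k * ((q ^ 2) ^ k * q * κ) := by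
  simp only [siteWeight]; ring

lemma siteWeight_periodic {N : ℕ} {q κ : ℂ} (hq : q ^ N = 1) (hκ : κ ^ N = 1) :
    Function.Periodic (siteWeight q κ) N := by
  intro k
  have : (k + N) ^ 2 = k ^ 2 + N * (2 * k + N) := by ring
  rw [siteWeight, siteWeight, this, pow_add, pow_mul, hq, one_pow, mul_one, pow_add, hκ, mul_one]

/-- The standing assumptions: `q` is the square root of the primitive `N`th root of unity `ω` that
is a power of `ω`, the parameters do not vanish, and the values `r_j` describe rational components
of the spectral curve, of which only the equations of the fibre over `x = 0` are used. -/
structure Degenerate {L : ℕ} [NeZero L] (M : ℕ) (ω q : ℂ) (h : Fin L → LParam)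
    (r : Fin L → ℂ) : Prop where
  root : IsPrimitiveRoot ω (2 * M + 1)
  q_eq : q = ω ^ (M + 1)
  ne : ∀ j, (h j).a ≠ 0 ∧ (h j).b ≠ 0 ∧ (h j).c ≠ 0 ∧ (h j).d ≠ 0
  r_sq : ∀ j, r (j + 1) ^ 2 = ((h j).b * (h j).d) / ((h j).a * (h j).c)
  fibre : ∀ j, (r j * (h j).d) ^ (2 * M + 1) = (r (j + 1) * (h j).a) ^ (2 * M + 1)

namespace Degenerate

variable {L : ℕ} [NeZero L] {M : ℕ} {ω q : ℂ} {h : Fin L → LParam} {r : Fin L → ℂ}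

lemma pow_eq_one (H : Degenerate M ω q h r) : ω ^ (2 * M + 1) = 1 := H.root.pow_eq_one

lemma q_pow (H : Degenerate M ω q h r) : q ^ (2 * M + 1) = 1 := by
  rw [H.q_eq, ← pow_mul, mul_comm, pow_mul, H.pow_eq_one, one_pow]

lemma q_sq (H : Degenerate M ω q h r) : q ^ 2 = ω := by
  rw [H.q_eq, ← pow_mul]
  calc ω ^ ((M + 1) * 2) = ω ^ (2 * M + 1) * ω := by ring
    _ = ω := by rw [H.pow_eq_one, one_mul]

lemma q_ne_zero (H : Degenerate M ω q h r) : q ≠ 0 := by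
  intro h0
  have := H.q_pow
  simp [h0] at this

lemma omega_ne_zero (H : Degenerate M ω q h r) : ω ≠ 0 := by
  rw [← H.q_sq]; exact pow_ne_zero _ H.q_ne_zero

lemma r_ne_zero (H : Degenerate M ω q h r) (j : Fin L) : r j ≠ 0 := by
  intro h0
  have h1 := H.r_sq (j - 1)
  obtain ⟨ha, hb, hc, hd⟩ := H.ne (j - 1)
  rw [sub_add_cancel, h0, zero_pow two_ne_zero] at h1
  exact div_ne_zero (mul_ne_zero hb hd) (mul_ne_zero ha hc) h1.symm

lemma b_eq (H : Degenerate M ω q h r) (j : Fin L) :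
    (h j).b = r (j + 1) * (h j).a * cstar h r j := by
  obtain ⟨ha, hb, hc, hd⟩ := H.ne j
  have := H.r_sq j
  rw [cstar]
  field_simp at this ⊢
  linear_combination -this

lemma c_eq (H : Degenerate M ω q h r) (j : Fin L) :
    (h j).c = (h j).d * cstar h r j / r (j + 1) := by
  obtain ⟨ha, hb, hc, hd⟩ := H.ne j
  have := H.r_ne_zero (j + 1)
  rw [cstar]
  field_simp

lemma kappa_pow (H : Degenerate M ω q h r) (j : Fin L) : kappa q h r j ^ (2 * M + 1) = 1 := by
  have h1 := H.r_ne_zero j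
  have hd := (H.ne j).2.2.2
  have e : kappa q h r j = q * ((r (j + 1) * (h j).a) / (r j * (h j).d)) := by
    rw [kappa]; field_simp
  rw [e, mul_pow, H.q_pow, one_mul, div_pow, H.fibre j, div_self]
  rw [← H.fibre j]
  exact pow_ne_zero _ (mul_ne_zero h1 hd)

lemma kappa_ne_zero (H : Degenerate M ω q h r) (j : Fin L) : kappa q h r j ≠ 0 := by
  intro h0
  have := H.kappa_pow j
  simp [h0] at this

lemma regular_pow (_H : Degenerate M ω q h r) {x : ℂ}
    (hx : x ∈ regularPoints (2 * M + 1) (cstar h r)) (j : Fin L) :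
    (x * cstar h r j) ^ (2 * M + 1) ≠ 1 := by
  rw [mul_pow]; exact hx j

lemma regular_mul (_H : Degenerate M ω q h r) {x z : ℂ} (hz : z ^ (2 * M + 1) = 1)
    (hx : x ∈ regularPoints (2 * M + 1) (cstar h r)) :
    z * x ∈ regularPoints (2 * M + 1) (cstar h r) := by
  intro j
  rw [mul_pow, hz, one_mul]; exact hx j

lemma siteWeight_per (H : Degenerate M ω q h r) (j : Fin L) :
    Function.Periodic (siteWeight q (kappa q h r j)) (2 * M + 1) :=
  siteWeight_periodic H.q_pow (H.kappa_pow j)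

/-- The component of one tensor factor of the vacuum state. On a rational component of the curve
`x b_j = r_{j+1} a_j (x c*_j)`, so that the recursion only involves `x c*_j`. -/
lemma vacuum_site (H : Degenerate M ω q h r) {x : ℂ}
    (hx : x ∈ regularPoints (2 * M + 1) (cstar h r)) (l : ℤ) (j : Fin L) (n : ℕ) :
    ∏ i ∈ Finset.range n,
      (sheet q r l (j + 1) * (h j).a * ω ^ (i + 1) - x * (h j).b) /
        (-sheet q r l j * (sheet q r l (j + 1) * x * (h j).c * ω ^ (i + 1) - (h j).d)) =
    siteWeight q (kappa q h r j) n *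
      (shiftedFactorial (x * cstar h r j * q ^ (-l - 2)) ω⁻¹ n /
        shiftedFactorial (x * cstar h r j * q ^ (l + 2)) ω n) := by
  have hq0 := H.q_ne_zero
  have hω0 := H.omega_ne_zero
  obtain ⟨ha, hb, hc, hd⟩ := H.ne j
  have hr0 := H.r_ne_zero j
  have hr1 := H.r_ne_zero (j + 1)
  induction n with
  | zero => simp [shiftedFactorial_zero, siteWeight]
  | succ n ih =>
    have hreg : (x * cstar h r j * q ^ (l + 2)) ^ (2 * M + 1) ≠ 1 := by
      rw [mul_pow, ← zpow_natCast (q ^ (l + 2)), ← _root_.zpow_mul, mul_comm, mul_comm (l + 2),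
        _root_.zpow_mul, zpow_natCast, H.q_pow, _root_.one_zpow, one_mul]
      exact H.regular_pow hx j
    have hD := one_sub_mul_pow_ne_zero H.pow_eq_one hreg n
    rw [Finset.prod_range_succ, ih, shiftedFactorial_succ, shiftedFactorial_succ, siteWeight_succ,
      mul_div_mul_comm, mul_mul_mul_comm]
    congr 1
    have e1 : q ^ (l + 2) * ω ^ n = q ^ l * ω ^ (n + 1) := by
      rw [zpow_add₀ hq0, pow_succ']
      norm_cast
      rw [H.q_sq]; ring
    have e2 : q ^ (-l - 2) * ω⁻¹ ^ n = (q ^ l * ω ^ (n + 1))⁻¹ := by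
      rw [← e1, mul_inv, ← _root_.zpow_neg, inv_pow]; congr 2; ring
    rw [mul_assoc _ (q ^ (l + 2)), e1] at hD ⊢
    rw [mul_assoc _ (q ^ (-l - 2)), e2, H.q_sq]
    simp only [sheet]
    have hQ : q ^ l ≠ 0 := zpow_ne_zero _ hq0
    have hW : ω ^ n ≠ 0 := pow_ne_zero _ hω0
    rw [H.b_eq, H.c_eq, kappa, pow_succ]
    rw [pow_succ] at hD
    generalize cstar h r j = cs at *
    generalize q ^ l = Q at *
    have hD' : (h j).d * (1 - x * cs * (Q * (ω ^ n * ω))) ≠ 0 := mul_ne_zero hd hD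
    have e3 : r (j + 1) * Q * x * ((h j).d * cs / r (j + 1)) * (ω ^ n * ω) - (h j).d =
        -((h j).d * (1 - x * cs * (Q * (ω ^ n * ω)))) := by field_simp; ring
    rw [e3, ← H.q_sq] at *
    generalize 1 - x * cs * (Q * ((q ^ 2) ^ n * q ^ 2)) = D at *
    generalize (q ^ 2) ^ n = W at *
    field_simp

lemma vac_apply (H : Degenerate M ω q h r) {x : ℂ}
    (hx : x ∈ regularPoints (2 * M + 1) (cstar h r)) (l : ℤ) (k : Fin L → ZMod (2 * M + 1)) :
    vac (2 * M + 1) L ω q h r l x k =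
      (∏ j, siteWeight q (kappa q h r j) (k j).val) *
        ∏ j, (shiftedFactorial (x * cstar h r j * q ^ (-l - 2)) ω⁻¹ (k j).val /
          shiftedFactorial (x * cstar h r j * q ^ (l + 2)) ω (k j).val) := by
  rw [vac, vacuum, ← Finset.prod_mul_distrib]
  exact Finset.prod_congr rfl fun j _ => H.vacuum_site hx l j _

lemma ketEven_apply (H : Degenerate M ω q h r) {x : ℂ}
    (hx : x ∈ regularPoints (2 * M + 1) (cstar h r)) (l : ℤ) (k : Fin L → ZMod (2 * M + 1)) :
    ketEven (2 * M + 1) L ω q h r l x k =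
      (∏ j, siteWeight q (kappa q h r j) (k j).val) *
        twistedSum (2 * M + 1) (ω ^ l) (fun j => evenRatio ω (x * cstar h r j))
          (fun j => (k j).val) := by
  rw [ketEven, Finset.sum_apply, twistedSum, Finset.mul_sum]
  refine Finset.sum_congr rfl fun n _ => ?_
  rw [Pi.smul_apply, smul_eq_mul, H.vac_apply hx, _root_.zpow_mul, zpow_natCast, fEven]
  have e1 : q ^ (2 * (n : ℤ) + 2) = ω ^ (n + 1) := by
    rw [← H.q_sq, ← pow_mul, ← zpow_natCast]; congr 1
  have e2 : q ^ (-(2 * (n : ℤ)) - 2) = ω⁻¹ ^ (n + 1) := by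
    rw [inv_pow, ← e1, ← _root_.zpow_neg]; congr 1; ring
  simp only [e1, e2, evenRatio, shiftedFactorial_add _ _ (n + 1), mul_div_mul_comm,
    Finset.prod_mul_distrib]
  ring

lemma ketOdd_apply (H : Degenerate M ω q h r) {x : ℂ}
    (hx : x ∈ regularPoints (2 * M + 1) (cstar h r)) (l : ℤ) (k : Fin L → ZMod (2 * M + 1)) :
    ketOdd (2 * M + 1) L ω q h r l x k =
      (∏ j, siteWeight q (kappa q h r j) (k j).val) *
        twistedSum (2 * M + 1) (ω ^ l) (fun j => oddRatio ω q (x * cstar h r j))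
          (fun j => (k j).val) := by
  rw [ketOdd, Finset.sum_apply, twistedSum, Finset.mul_sum]
  refine Finset.sum_congr rfl fun n _ => ?_
  rw [Pi.smul_apply, smul_eq_mul, H.vac_apply hx, _root_.zpow_mul, zpow_natCast, fOdd]
  have e1 : q ^ (2 * (n : ℤ) + 1 + 2) = q * ω ^ (n + 1) := by
    rw [← H.q_sq, ← pow_mul, ← pow_succ', ← zpow_natCast]; congr 1
  have e2 : q ^ (-(2 * (n : ℤ) + 1) - 2) = q⁻¹ * ω⁻¹ ^ (n + 1) := by
    rw [inv_pow, ← mul_inv, ← e1, ← _root_.zpow_neg]; congr 1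
  simp only [e1, e2, oddRatio, shiftedFactorial_add _ _ (n + 1), mul_div_mul_comm,
    Finset.prod_mul_distrib, ← mul_assoc]
  ring

lemma omega_zpow_pow (H : Degenerate M ω q h r) (l : ℤ) : (ω ^ l) ^ (2 * M + 1) = 1 := by
  rw [← zpow_natCast, ← _root_.zpow_mul, mul_comm, _root_.zpow_mul, zpow_natCast,
    H.pow_eq_one, _root_.one_zpow]

lemma evenRatio_per (H : Degenerate M ω q h r) {x : ℂ}
    (hx : x ∈ regularPoints (2 * M + 1) (cstar h r)) (j : Fin L) :
    Function.Periodic (evenRatio ω (x * cstar h r j)) (2 * M + 1) :=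
  evenRatio_periodic (by omega) H.pow_eq_one (H.regular_pow hx j)

lemma uFun_q_mul (H : Degenerate M ω q h r) (x : ℂ) :
    uFun M q (cstar h r) (q * x) = (∏ j, (1 - x ^ (2 * M + 1) * cstar h r j ^ (2 * M + 1))) *
      ∏ j, shiftedFactorial (x * cstar h r j * ω) ω M := by
  rw [uFun, Finset.prod_mul_distrib, mul_pow, H.q_pow, one_mul, H.q_sq]
  congr 1
  refine Finset.prod_congr rfl fun j _ => ?_
  rw [← H.q_sq]; congr 1; ring

/-- Both vectors are proportional, since the odd one is the even one with the summation index
advanced by half a period. -/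
lemma ketEven_eq_ketOdd (H : Degenerate M ω q h r) {x : ℂ}
    (hx : x ∈ regularPoints (2 * M + 1) (cstar h r)) (l : ℤ) :
    uFun M q (cstar h r) (q * x) • ketEven (2 * M + 1) L ω q h r l x =
      (q ^ l * uFun M q (cstar h r) x) • ketOdd (2 * M + 1) L ω q h r l x := by
  funext k
  rw [Pi.smul_apply, Pi.smul_apply, smul_eq_mul, smul_eq_mul, H.ketEven_apply hx,
    H.ketOdd_apply hx, H.uFun_q_mul, uFun, Finset.prod_mul_distrib, H.q_sq,
    ← twistedSum_shift (H.omega_zpow_pow l) (H.evenRatio_per hx) (M + 1)]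
  have ht : (ω ^ l) ^ (M + 1) = q ^ l := by
    rw [H.q_eq, ← zpow_natCast, ← zpow_natCast, ← _root_.zpow_mul, ← _root_.zpow_mul, mul_comm]
  have key : (∏ j, shiftedFactorial (x * cstar h r j * ω) ω M) *
      twistedSum (2 * M + 1) (ω ^ l) (fun j m => evenRatio ω (x * cstar h r j) (m + (M + 1)))
        (fun j => (k j).val) =
      (∏ j, shiftedFactorial (x * cstar h r j * q) ω M) *
      twistedSum (2 * M + 1) (ω ^ l) (fun j => oddRatio ω q (x * cstar h r j))
        (fun j => (k j).val) := by
    simp only [twistedSum, Finset.mul_sum]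
    refine Finset.sum_congr rfl fun n _ => ?_
    rw [mul_left_comm, ← Finset.prod_mul_distrib, mul_left_comm, ← Finset.prod_mul_distrib]
    congr 1
    exact Finset.prod_congr rfl fun j _ =>
      (oddRatio_eq_evenRatio H.pow_eq_one H.q_eq (H.regular_pow hx j) _).symm
  rw [ht]
  linear_combination (q ^ l * (∏ j, (1 - x ^ (2 * M + 1) * cstar h r j ^ (2 * M + 1))) *
    ∏ j, siteWeight q (kappa q h r j) (k j).val) * key

lemma ketPlus_eq_ketEven (H : Degenerate M ω q h r) {x : ℂ}
    (hx : x ∈ regularPoints (2 * M + 1) (cstar h r)) (l : ℤ) :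
    ketPlus M L ω q h r l x =
      (2 * q ^ (-l) * uFun M q (cstar h r) (q * x)) • ketEven (2 * M + 1) L ω q h r l x := by
  have h0 : q ^ (-l) * q ^ l = 1 := by
    rw [← zpow_add₀ H.q_ne_zero, neg_add_cancel, zpow_zero]
  have h1 := congrArg (q ^ (-l) • ·) (H.ketEven_eq_ketOdd hx l)
  simp only [smul_smul, ← mul_assoc, h0, one_mul] at h1
  rw [ketPlus, ← h1, ← add_smul, ← two_mul, mul_assoc]

lemma ketPlus_eq_ketOdd (H : Degenerate M ω q h r) {x : ℂ}
    (hx : x ∈ regularPoints (2 * M + 1) (cstar h r)) (l : ℤ) :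
    ketPlus M L ω q h r l x =
      (2 * uFun M q (cstar h r) x) • ketOdd (2 * M + 1) L ω q h r l x := by
  have h0 : q ^ (-l) * q ^ l = 1 := by
    rw [← zpow_add₀ H.q_ne_zero, neg_add_cancel, zpow_zero]
  have h1 := congrArg (q ^ (-l) • ·) (H.ketEven_eq_ketOdd hx l)
  simp only [smul_smul, ← mul_assoc, h0, one_mul] at h1
  rw [ketPlus, h1, ← add_smul, ← two_mul]

end Degenerate

/-! ### Transfer matrices on product vectors -/

/-- The matrix `B` becomes lower triangular after the gauge transformation
`!![1, ξ; 0, 1] * B * !![1, -ξ'; 0, 1]`, with diagonal entries `μ` and `lam`. -/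
structure GaugeTriangular (B : Matrix (Fin 2) (Fin 2) ℂ) (ξ ξ' μ lam : ℂ) : Prop where
  diag_fst : B 0 0 + ξ * B 1 0 = μ
  offDiag : B 0 1 + ξ * B 1 1 = μ * ξ'
  diag_snd : B 1 1 - ξ' * B 1 0 = lam

namespace GaugeTriangular

lemma one (ξ : ℂ) : GaugeTriangular 1 ξ ξ 1 1 := by
  constructor <;> simp

lemma mul {B B' : Matrix (Fin 2) (Fin 2) ℂ} {ξ ξ' ξ'' μ μ' lam lam' : ℂ}
    (h : GaugeTriangular B ξ ξ' μ lam) (h' : GaugeTriangular B' ξ' ξ'' μ' lam') :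
    GaugeTriangular (B * B') ξ ξ'' (μ * μ') (lam * lam') := by
  obtain ⟨h1, h2, h3⟩ := h
  obtain ⟨h1', h2', h3'⟩ := h'
  constructor <;> simp only [mul_apply, Fin.sum_univ_two]
  · linear_combination B' 0 0 * h1 + B' 1 0 * h2 + μ * h1'
  · linear_combination B' 0 1 * h1 + B' 1 1 * h2 + μ * h2'
  · linear_combination B 1 0 * h2' - ξ'' * B 1 0 * h1' + lam' * h3 + (B 1 1 - ξ' * B 1 0) * h3'

lemma trace_eq {B : Matrix (Fin 2) (Fin 2) ℂ} {ξ μ lam : ℂ} (h : GaugeTriangular B ξ ξ μ lam) :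
    B.trace = μ + lam := by
  rw [trace_fin_two]
  linear_combination h.diag_fst + h.diag_snd

lemma prod_ofFn {n : ℕ} {B : Fin n → Matrix (Fin 2) (Fin 2) ℂ} {ξ : ℕ → ℂ} {μ lam : Fin n → ℂ}
    (h : ∀ j : Fin n, GaugeTriangular (B j) (ξ j) (ξ (j + 1)) (μ j) (lam j)) :
    GaugeTriangular (List.ofFn B).prod (ξ 0) (ξ n) (∏ j, μ j) (∏ j, lam j) := by
  induction n generalizing ξ with
  | zero => simpa using one (ξ 0)
  | succ n ih =>
    rw [List.ofFn_succ, List.prod_cons, Fin.prod_univ_succ, Fin.prod_univ_succ]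
    refine (h 0).mul ?_
    have := ih (B := fun j => B j.succ) (ξ := fun i => ξ (i + 1)) (μ := fun j => μ j.succ)
      (lam := fun j => lam j.succ) (fun j => by simpa using h j.succ)
    simpa using this

end GaugeTriangular

/-- The gauge parameters being cyclic, they cancel in the trace. -/
lemma trace_prod_ofFn_of_gaugeTriangular {L : ℕ} [NeZero L]
    {B : Fin L → Matrix (Fin 2) (Fin 2) ℂ} {ξ μ lam : Fin L → ℂ}
    (h : ∀ j, GaugeTriangular (B j) (ξ j) (ξ (j + 1)) (μ j) (lam j)) :
    (List.ofFn B).prod.trace = ∏ j, μ j + ∏ j, lam j := by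
  refine GaugeTriangular.trace_eq (ξ := ξ (Fin.ofNat L 0)) ?_
  have h1 : ∀ j : Fin L, Fin.ofNat L j = j := fun j => by ext; simp
  have h2 : ∀ j : Fin L, Fin.ofNat L (j + 1) = j + 1 := fun j => by
    ext; simp [Fin.val_add, Nat.add_mod]
  have h3 : Fin.ofNat L L = Fin.ofNat L 0 := by ext; simp
  have := GaugeTriangular.prod_ofFn (B := B) (ξ := fun i => ξ (Fin.ofNat L i)) (μ := μ)
    (lam := lam) (fun j => by simpa only [h1, h2] using h j)
  simpa only [h3] using this

/-- The `L`-operator applied in its quantum space to the vector `w`, at the component `k`. -/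
def lOpVec (N : ℕ) [NeZero N] (ω : ℂ) (h : LParam) (x : ℂ) (w : ZMod N → ℂ) (k : ZMod N) :
    Matrix (Fin 2) (Fin 2) ℂ :=
  !![h.a * ω ^ k.val * w (k - 1), x * h.b * w (k - 1); x * h.c * ω ^ k.val * w k, h.d * w k]

lemma weylY_apply (N : ℕ) [NeZero N] (ω : ℂ) (k k' : ZMod N) :
    weylY N ω k k' = if k' = k - 1 then ω ^ k.val else 0 := by
  simp [weylY, weylZ, weylX, diagonal_mul]

lemma sum_smul_lOp (N : ℕ) [NeZero N] (ω : ℂ) (h : LParam) (x : ℂ) (w : ZMod N → ℂ)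
    (k : ZMod N) : ∑ k', w k' • lOp N ω h x k k' = lOpVec N ω h x w k := by
  ext i i'
  rw [Matrix.sum_apply]
  fin_cases i <;> fin_cases i' <;>
    simp [lOp, lOpVec, weylY_apply, weylX, weylZ, diagonal_apply, one_apply] <;> ring

/-- On a product vector the transfer matrix acts site by site. -/
lemma transferMatrix_mulVec_prod (N L : ℕ) [NeZero N] (ω : ℂ) (h : Fin L → LParam) (x : ℂ)
    (w : Fin L → ZMod N → ℂ) (k : Fin L → ZMod N) :
    (transferMatrix N L ω h x *ᵥ fun k => ∏ j, w j (k j)) k =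
      (List.ofFn fun j => lOpVec N ω (h j) x (w j) (k j)).prod.trace := by
  simp only [← sum_smul_lOp]
  have h1 := (MultilinearMap.mkPiAlgebraFin ℂ L (Matrix (Fin 2) (Fin 2) ℂ)).map_sum
    (fun j k' => w j k' • lOp N ω (h j) x (k j) k')
  simp only [MultilinearMap.map_smul_univ, MultilinearMap.mkPiAlgebraFin_apply] at h1
  rw [h1, trace_sum, mulVec, dotProduct]
  refine Finset.sum_congr rfl fun k' _ => ?_
  rw [trace_smul, transferMatrix, of_apply, smul_eq_mul, mul_comm]

/-! ### Action of the transfer matrix on the sums of vacuum states -/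

lemma sum_pow_mul_prod_eq_mul_twistedSum {L N : ℕ} {t : ℂ} (ht : t ^ N = 1) {g : Fin L → ℕ → ℂ}
    (hg : ∀ j, Function.Periodic (g j) N) (k : Fin L → ℕ) :
    ∑ n ∈ Finset.range N, t ^ n * ∏ j, g j (n + k j) = t * twistedSum N t g k := by
  have hper : Function.Periodic (fun n => t ^ n * ∏ j, g j (n + k j)) N := by
    intro n
    have : ∀ j, g j (n + N + k j) = g j (n + k j) := fun j => by
      rw [← hg j (n + k j)]; congr 1; ring
    simp only [this, pow_add, ht, mul_one]
  rw [twistedSum, ← sum_range_periodic_add hper 1, Finset.mul_sum]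
  refine Finset.sum_congr rfl fun n _ => ?_
  rw [pow_succ']
  ring

lemma one_sub_mul_oddRatio {ω q y : ℂ} (hq : q ^ 2 = ω) (hq0 : q ≠ 0) (m : ℕ) :
    (1 - y) * oddRatio ω q (q⁻¹ * y) m = evenRatio ω y m * (1 - y * ω⁻¹ ^ m) := by
  have e1 : q⁻¹ * y * q⁻¹ = y * ω⁻¹ := by rw [← hq]; field_simp
  have e2 : q⁻¹ * y * q = y := by field_simp
  rw [oddRatio, evenRatio, e1, e2, mul_div_assoc', ← shiftedFactorial_succ', div_mul_eq_mul_div,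
    ← shiftedFactorial_succ]

lemma one_add_mul_oddRatio {N : ℕ} {ω q y : ℂ} (hω : ω ^ N = 1) (hq : q ^ 2 = ω) (hq0 : q ≠ 0)
    (hy : y ^ N ≠ 1) (m : ℕ) :
    (1 + y) * oddRatio ω q (q * y) m = evenRatio ω y m * ((1 - y ^ 2) / (1 - y * ω ^ m)) := by
  have h1 := shiftedFactorial_ne_zero hω hy m
  have h2 := one_sub_mul_pow_ne_zero hω hy m
  have h3 : 1 - y ≠ 0 := by simpa using one_sub_mul_pow_ne_zero hω hy 0
  have h4 : shiftedFactorial (y * ω) ω m ≠ 0 :=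
    shiftedFactorial_ne_zero hω (by rwa [mul_pow, hω, mul_one]) m
  have e1 : q * y * q⁻¹ = y := by field_simp
  have e2 : q * y * q = y * ω := by rw [← hq]; ring
  have e3 := shiftedFactorial_succ y ω m
  rw [shiftedFactorial_succ'] at e3
  rw [oddRatio, evenRatio, e1, e2]
  generalize shiftedFactorial y ω⁻¹ m = A
  field_simp
  linear_combination -(1 + y) * A * e3

namespace Degenerate

variable {L : ℕ} [NeZero L] {M : ℕ} {ω q : ℂ} {h : Fin L → LParam} {r : Fin L → ℂ}

lemma omega_pow_val (H : Degenerate M ω q h r) (k : ZMod (2 * M + 1)) :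
    ω ^ ((k - 1).val + 1) = ω ^ k.val :=
  periodic_val_sub_one (g := fun i => ω ^ i)
    (fun i => by simp only [pow_add, H.pow_eq_one, mul_one]) k

lemma siteWeight_val (H : Degenerate M ω q h r) (j : Fin L) (k : ZMod (2 * M + 1)) :
    siteWeight q (kappa q h r j) k.val = siteWeight q (kappa q h r j) (k - 1).val *
      (ω ^ k.val * ((h j).a * r (j + 1) / ((h j).d * r j))) := by
  rw [← periodic_val_sub_one (H.siteWeight_per j), ← H.omega_pow_val k, siteWeight_succ, H.q_sq,
    pow_succ, ← H.q_sq, kappa]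
  ring

/-- One tensor factor of the `n`th summand of the even vector. -/
def evenSite (ω q : ℂ) (h : Fin L → LParam) (r : Fin L → ℂ) (x : ℂ) (n : ℕ) (j : Fin L)
    (k : ZMod (2 * M + 1)) : ℂ :=
  siteWeight q (kappa q h r j) k.val * evenRatio ω (x * cstar h r j) (n + 1 + k.val)

/-- The vacuum vector is the one annihilated by an off-diagonal entry of the gauge transformed
`L`-operator. -/
lemma gaugeTriangular_lOpVec (H : Degenerate M ω q h r) {x : ℂ}
    (hx : x ∈ regularPoints (2 * M + 1) (cstar h r)) (n : ℕ) (j : Fin L)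
    (k : ZMod (2 * M + 1)) :
    GaugeTriangular (lOpVec (2 * M + 1) ω (h j) x (evenSite ω q h r x n j) k)
      (r j * ω ^ n) (r (j + 1) * ω ^ n)
      ((h j).d * (r j / r (j + 1)) * siteWeight q (kappa q h r j) k.val *
        ((1 + x * cstar h r j) * oddRatio ω q (q * (x * cstar h r j)) (n + k.val)))
      ((h j).d * siteWeight q (kappa q h r j) k.val *
        ((1 - x * cstar h r j) * oddRatio ω q (q⁻¹ * (x * cstar h r j)) (n + k.val))) := by
  have hy := H.regular_pow hx j
  rw [one_sub_mul_oddRatio H.q_sq H.q_ne_zero,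
    one_add_mul_oddRatio H.pow_eq_one H.q_sq H.q_ne_zero hy]
  have hb := H.b_eq j
  have hc := H.c_eq j
  obtain ⟨ha, -, -, hd⟩ := H.ne j
  have hr0 := H.r_ne_zero j
  have hr1 := H.r_ne_zero (j + 1)
  have hω0 := H.omega_ne_zero
  have hκ := H.siteWeight_val j k
  have hE := H.evenRatio_per hx j
  generalize hyy : x * cstar h r j = y at *
  have hxc : x * (h j).c = (h j).d * y / r (j + 1) := by rw [hc, ← hyy]; ring
  have hxb : x * (h j).b = r (j + 1) * (h j).a * y := by rw [hb, ← hyy]; ring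
  have p2 := H.omega_pow_val k
  have p3 : ∀ s, evenRatio ω y (s + ((k - 1).val + 1)) = evenRatio ω y (s + k.val) := fun s =>
    periodic_val_sub_one (g := fun i => evenRatio ω y (s + i))
      (fun i => by simp only [← add_assoc]; exact hE _) k
  have p4 : ω ^ (n + k.val) = ω ^ n * ω ^ k.val := pow_add _ _ _
  have p5 : evenRatio ω y (n + 1 + k.val) = evenRatio ω y (n + k.val) *
      ((1 - y * ω⁻¹ ^ (n + k.val)) / (1 - y * ω ^ (n + k.val))) := by
    have e1 := evenRatio_succ ω y (n + ((k - 1).val + 1))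
    have e2 : n + ((k - 1).val + 1) + 1 = n + 1 + ((k - 1).val + 1) := by ring
    rwa [e2, p3, p3, inv_pow, pow_add, p2, ← p4, ← inv_pow] at e1
  have p6 : evenRatio ω y (n + 1 + (k - 1).val) = evenRatio ω y (n + k.val) := by
    rw [← p3]; congr 1; ring
  have hD := one_sub_mul_pow_ne_zero H.pow_eq_one hy (n + k.val)
  rw [inv_pow, p4] at p5 ⊢
  rw [p4] at hD
  have hu : ω ^ n ≠ 0 := pow_ne_zero _ hω0
  have hv : ω ^ k.val ≠ 0 := pow_ne_zero _ hω0
  simp only [evenSite, lOpVec, hyy, p5, p6, hκ, hxc, hxb]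
  generalize siteWeight q (kappa q h r j) (k - 1).val = W
  generalize evenRatio ω y (n + k.val) = e
  generalize ω ^ n = u at *
  generalize ω ^ k.val = v at *
  obtain ⟨D, hDe⟩ : ∃ D, D = 1 - y * (u * v) := ⟨_, rfl⟩
  rw [← hDe] at hD ⊢
  constructor <;> simp only [of_apply, cons_val', cons_val_zero, cons_val_one, cons_val_fin_one]
  · field_simp
    rw [hDe]; ring
  · field_simp
    rw [hDe]; ring
  · field_simp
    rw [hDe]; ring

lemma prod_r_div (H : Degenerate M ω q h r) : ∏ j, r j / r (j + 1) = 1 := by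
  have h1 : ∏ j, r (j + 1) = ∏ j, r j := Equiv.prod_comp (Equiv.addRight (1 : Fin L)) r
  rw [Finset.prod_div_distrib, h1]
  exact div_self (Finset.prod_ne_zero_iff.2 fun j _ => H.r_ne_zero j)

lemma ketEven_eq_sum (H : Degenerate M ω q h r) {x : ℂ}
    (hx : x ∈ regularPoints (2 * M + 1) (cstar h r)) (l : ℤ) :
    ketEven (2 * M + 1) L ω q h r l x = ∑ n ∈ Finset.range (2 * M + 1),
      (ω ^ l) ^ n • fun k : Fin L → ZMod (2 * M + 1) => ∏ j, evenSite ω q h r x n j (k j) := by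
  funext k
  rw [H.ketEven_apply hx, Finset.sum_apply, twistedSum, Finset.mul_sum]
  refine Finset.sum_congr rfl fun n _ => ?_
  simp only [evenSite, Pi.smul_apply, smul_eq_mul, Finset.prod_mul_distrib]
  ring

/-- The transfer matrix sends even vectors to odd ones. -/
lemma normTransfer_mulVec_ketEven (H : Degenerate M ω q h r) {x : ℂ}
    (hx : x ∈ regularPoints (2 * M + 1) (cstar h r)) (l : ℤ) :
    normTransfer (2 * M + 1) L ω h x *ᵥ ketEven (2 * M + 1) L ω q h r l x =
      ω ^ l • ((∏ j, (1 - x * cstar h r j)) • ketOdd (2 * M + 1) L ω q h r l (q⁻¹ * x) +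
        (∏ j, (1 + x * cstar h r j)) • ketOdd (2 * M + 1) L ω q h r l (q * x)) := by
  have hd : ∏ j, (h j).d ≠ 0 := Finset.prod_ne_zero_iff.2 fun j _ => (H.ne j).2.2.2
  have hx1 := H.regular_mul (z := q⁻¹) (by rw [inv_pow, H.q_pow, inv_one]) hx
  have hx2 := H.regular_mul H.q_pow hx
  have ht := H.omega_zpow_pow l
  funext k
  rw [normTransfer, smul_mulVec, Pi.smul_apply, smul_eq_mul, inv_mul_eq_iff_eq_mul₀ hd,
    H.ketEven_eq_sum hx, mulVec_sum, Finset.sum_apply]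
  simp only [mulVec_smul, Pi.smul_apply, smul_eq_mul, Pi.add_apply, transferMatrix_mulVec_prod]
  rw [H.ketOdd_apply hx1, H.ketOdd_apply hx2]
  have per1 : ∀ j, Function.Periodic (fun m => (1 - x * cstar h r j) *
      oddRatio ω q (q⁻¹ * (x * cstar h r j)) m) (2 * M + 1) := fun j m => by
    simp only [one_sub_mul_oddRatio H.q_sq H.q_ne_zero]
    rw [H.evenRatio_per hx j, pow_add, inv_pow ω (2 * M + 1), H.pow_eq_one, inv_one, mul_one]
  have per2 : ∀ j, Function.Periodic (fun m => (1 + x * cstar h r j) *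
      oddRatio ω q (q * (x * cstar h r j)) m) (2 * M + 1) := fun j m => by
    simp only [one_add_mul_oddRatio H.pow_eq_one H.q_sq H.q_ne_zero (H.regular_pow hx j)]
    rw [H.evenRatio_per hx j, pow_add, H.pow_eq_one, mul_one]
  have pull : ∀ (c : Fin L → ℂ) (g : Fin L → ℕ → ℂ),
      twistedSum (2 * M + 1) (ω ^ l) (fun j m => c j * g j m) (fun j => (k j).val) =
        (∏ j, c j) * twistedSum (2 * M + 1) (ω ^ l) g (fun j => (k j).val) := fun c g => by
    simp only [twistedSum, Finset.mul_sum, Finset.prod_mul_distrib]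
    exact Finset.sum_congr rfl fun n _ => by ring
  have s1 := sum_pow_mul_prod_eq_mul_twistedSum ht per1 (fun j => (k j).val)
  have s2 := sum_pow_mul_prod_eq_mul_twistedSum ht per2 (fun j => (k j).val)
  rw [pull] at s1 s2
  have expand : ∀ n, (ω ^ l) ^ n * (List.ofFn fun j => lOpVec (2 * M + 1) ω (h j) x
      (evenSite ω q h r x n j) (k j)).prod.trace =
      (∏ j, (h j).d) * (∏ j, siteWeight q (kappa q h r j) (k j).val) * ((ω ^ l) ^ n *
        ∏ j, (1 + x * cstar h r j) * oddRatio ω q (q * (x * cstar h r j)) (n + (k j).val)) +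
      (∏ j, (h j).d) * (∏ j, siteWeight q (kappa q h r j) (k j).val) * ((ω ^ l) ^ n *
        ∏ j, (1 - x * cstar h r j) * oddRatio ω q (q⁻¹ * (x * cstar h r j)) (n + (k j).val)) := by
    intro n
    rw [trace_prod_ofFn_of_gaugeTriangular fun j => H.gaugeTriangular_lOpVec hx n j (k j), mul_add]
    simp only [Finset.prod_mul_distrib, H.prod_r_div, mul_one]
    ring
  have a1 : ∀ j, q⁻¹ * x * cstar h r j = q⁻¹ * (x * cstar h r j) := fun j => mul_assoc _ _ _
  have a2 : ∀ j, q * x * cstar h r j = q * (x * cstar h r j) := fun j => mul_assoc _ _ _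
  simp only [expand, Finset.sum_add_distrib, ← Finset.mul_sum, s1, s2, a1, a2]
  ring

lemma deltaPlus_zero (H : Degenerate M ω q h r) {x : ℂ}
    (hx : x ∈ regularPoints (2 * M + 1) (cstar h r)) :
    deltaPlus q (cstar h r) x 0 = ∏ j, (1 + x * cstar h r j) := by
  rw [deltaPlus]
  refine Finset.prod_congr rfl fun j _ => ?_
  have h3 : 1 - x * cstar h r j ≠ 0 := by
    simpa using one_sub_mul_pow_ne_zero H.pow_eq_one (H.regular_pow hx j) 0
  rw [neg_zero, zpow_zero, mul_one, div_eq_iff h3]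
  ring

/-- The `TQ` relation on the level of vectors: combine the action on even vectors with the
proportionality of even and odd ones. -/
lemma normTransfer_mulVec_ketPlus (H : Degenerate M ω q h r) {x : ℂ}
    (hx : x ∈ regularPoints (2 * M + 1) (cstar h r)) (l : ℤ) :
    q ^ (-l) • (normTransfer (2 * M + 1) L ω h x *ᵥ ketPlus M L ω q h r l x) =
      deltaMinus q (cstar h r) x (-1) • ketPlus M L ω q h r l (q⁻¹ * x) +
        deltaPlus q (cstar h r) x 0 • ketPlus M L ω q h r l (q * x) := by
  have hq0 := H.q_ne_zero
  have hx1 := H.regular_mul (z := q⁻¹) (by rw [inv_pow, H.q_pow, inv_one]) hx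
  have hx2 := H.regular_mul H.q_pow hx
  rw [H.ketPlus_eq_ketEven hx, H.ketPlus_eq_ketOdd hx1, H.ketPlus_eq_ketOdd hx2, mulVec_smul,
    H.normTransfer_mulVec_ketEven hx]
  simp only [smul_add, smul_smul]
  have hl : q ^ (-l) * q ^ (-l) * ω ^ l = 1 := by
    rw [← H.q_sq, ← zpow_natCast, ← _root_.zpow_mul, ← zpow_add₀ hq0, ← zpow_add₀ hq0]
    have : -l + -l + ((2 : ℕ) : ℤ) * l = 0 := by push_cast; ring
    rw [this, zpow_zero]
  -- `(y ω ; ω)_M (1 - y) = (y ; ω)_{M + 1} = (y ; ω)_M (1 - y ω ^ M)` and `ω ^ M = q⁻¹`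
  have hminus : uFun M q (cstar h r) (q * x) * ∏ j, (1 - x * cstar h r j) =
      deltaMinus q (cstar h r) x (-1) * uFun M q (cstar h r) (q⁻¹ * x) := by
    have hM : ω ^ M = q⁻¹ := by
      refine eq_inv_of_mul_eq_one_left ?_
      rw [H.q_eq, ← pow_add, ← H.pow_eq_one]
      congr 1; ring
    have key : (∏ j, shiftedFactorial (x * cstar h r j * ω) ω M) * ∏ j, (1 - x * cstar h r j) =
        (∏ j, (1 - x * cstar h r j * q ^ (-1 : ℤ))) *
          ∏ j, shiftedFactorial (q⁻¹ * x * cstar h r j * q) (q ^ 2) M := by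
      rw [← Finset.prod_mul_distrib, ← Finset.prod_mul_distrib]
      refine Finset.prod_congr rfl fun j _ => ?_
      have e : q⁻¹ * x * cstar h r j * q = x * cstar h r j := by field_simp
      rw [e, H.q_sq, mul_comm, ← shiftedFactorial_succ', shiftedFactorial_succ, hM,
        _root_.zpow_neg_one, mul_comm]
    rw [H.uFun_q_mul, deltaMinus, uFun, Finset.prod_mul_distrib, mul_pow, inv_pow, H.q_pow,
      inv_one, one_mul]
    linear_combination (∏ j, (1 - x ^ (2 * M + 1) * cstar h r j ^ (2 * M + 1))) * key
  rw [H.deltaPlus_zero hx]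
  congr 2
  · linear_combination (2 * uFun M q (cstar h r) (q * x) * ∏ j, (1 - x * cstar h r j)) * hl +
      2 * hminus
  · linear_combination (2 * uFun M q (cstar h r) (q * x) * ∏ j, (1 + x * cstar h r j)) * hl

end Degenerate

/-! ### Polynomiality and parity of the transfer matrix -/

/-- The `L`-operator with the spectral parameter as an indeterminate. -/
def lOpPoly (N : ℕ) [NeZero N] (ω : ℂ) (h : LParam) (k k' : ZMod N) :
    Matrix (Fin 2) (Fin 2) ℂ[X] :=
  !![C (h.a * weylY N ω k k'), X * C (h.b * weylX N k k');
     X * C (h.c * weylZ N ω k k'), C (h.d * (1 : Matrix (ZMod N) (ZMod N) ℂ) k k')]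

lemma eval_lOpPoly (N : ℕ) [NeZero N] (ω : ℂ) (h : LParam) (k k' : ZMod N) (x : ℂ) :
    (evalRingHom x).mapMatrix (lOpPoly N ω h k k') = lOp N ω h x k k' := by
  ext i i'
  fin_cases i <;> fin_cases i' <;> simp [lOpPoly, lOp, mul_assoc]

lemma natDegree_lOpPoly_le (N : ℕ) [NeZero N] (ω : ℂ) (h : LParam) (k k' : ZMod N)
    (i i' : Fin 2) : (lOpPoly N ω h k k' i i').natDegree ≤ 1 := by
  fin_cases i <;> fin_cases i' <;> simp only [lOpPoly, of_apply, cons_val', cons_val_zero,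
    cons_val_one, cons_val_fin_one, Fin.zero_eta, Fin.mk_one] <;> compute_degree!

lemma natDegree_prod_ofFn_le {n : ℕ} {B : Fin n → Matrix (Fin 2) (Fin 2) ℂ[X]}
    (hB : ∀ j i i', (B j i i').natDegree ≤ 1) (i i' : Fin 2) :
    ((List.ofFn B).prod i i').natDegree ≤ n := by
  induction n generalizing i with
  | zero =>
    rw [List.ofFn_zero, List.prod_nil, one_apply]
    split_ifs <;> simp
  | succ n ih =>
    rw [List.ofFn_succ, List.prod_cons, mul_apply]
    refine natDegree_sum_le_of_forall_le _ _ fun s _ => ?_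
    exact (natDegree_mul_le_of_le (hB _ _ _) (ih (fun j => hB j.succ) s)).trans (add_comm 1 n).le

lemma exists_polynomial_transferMatrix (N L : ℕ) [NeZero N] (ω : ℂ) (h : Fin L → LParam)
    (k k' : Fin L → ZMod N) :
    ∃ p : ℂ[X], p.natDegree ≤ L ∧ ∀ x, p.eval x = transferMatrix N L ω h x k k' := by
  refine ⟨(List.ofFn fun j => lOpPoly N ω (h j) (k j) (k' j)).prod.trace, ?_, fun x => ?_⟩
  · rw [trace_fin_two]
    exact (natDegree_add_le _ _).trans (max_le
      (natDegree_prod_ofFn_le (fun j => natDegree_lOpPoly_le _ _ _ _ _) _ _)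
      (natDegree_prod_ofFn_le (fun j => natDegree_lOpPoly_le _ _ _ _ _) _ _))
  · rw [transferMatrix, of_apply, ← coe_evalRingHom, AddMonoidHom.map_trace,
      ← RingHom.mapMatrix_apply, map_list_prod, List.map_ofFn]
    simp only [Function.comp_def, eval_lOpPoly]

lemma semiconjBy_prod_ofFn {R : Type*} [Monoid R] {n : ℕ} {s : R} {B B' : Fin n → R}
    (hB : ∀ j, SemiconjBy s (B j) (B' j)) :
    SemiconjBy s (List.ofFn B).prod (List.ofFn B').prod := by
  induction n with
  | zero => simp
  | succ n ih =>
    simp only [List.ofFn_succ, List.prod_cons]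
    exact (hB 0).mul_right (ih fun j => hB j.succ)

/-- Conjugation by the third Pauli matrix changes the sign of the spectral parameter. -/
lemma transferMatrix_neg (N L : ℕ) [NeZero N] (ω : ℂ) (h : Fin L → LParam) (x : ℂ) :
    transferMatrix N L ω h (-x) = transferMatrix N L ω h x := by
  ext k k'
  rw [transferMatrix, transferMatrix, of_apply, of_apply]
  have hss : (!![1, 0; 0, -1] : Matrix (Fin 2) (Fin 2) ℂ) * !![1, 0; 0, -1] = 1 := by
    simp [one_fin_two]
  have hconj : SemiconjBy (!![1, 0; 0, -1] : Matrix (Fin 2) (Fin 2) ℂ)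
      (List.ofFn fun j => lOp N ω (h j) x (k j) (k' j)).prod
      (List.ofFn fun j => lOp N ω (h j) (-x) (k j) (k' j)).prod := by
    refine semiconjBy_prod_ofFn fun j => ?_
    rw [SemiconjBy, lOp, lOp]
    simp
  rw [← Matrix.mul_one (List.ofFn fun j => lOp N ω (h j) (-x) (k j) (k' j)).prod, ← hss,
    ← Matrix.mul_assoc, ← hconj.eq, trace_mul_comm, ← Matrix.mul_assoc, hss, Matrix.one_mul]

lemma transferMatrix_zero (N L : ℕ) [NeZero N] [NeZero L] (ω : ℂ) (h : Fin L → LParam)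
    (k k' : Fin L → ZMod N) :
    transferMatrix N L ω h 0 k k' =
      (if k = k' + 1 then ∏ j, (h j).a * ω ^ (k j).val else 0) +
        if k = k' then ∏ j, (h j).d else 0 := by
  have h1 : ∀ j, GaugeTriangular (lOp N ω (h j) 0 (k j) (k' j)) 0 0
      (if k j = k' j + 1 then (h j).a * ω ^ (k j).val else 0)
      (if k j = k' j then (h j).d else 0) := fun j => by
    have e : k' j = k j - 1 ↔ k j = k' j + 1 := by
      rw [eq_sub_iff_add_eq, eq_comm]
    constructor <;> simp [lOp, weylY_apply, one_apply, e]
  rw [transferMatrix, of_apply, trace_prod_ofFn_of_gaugeTriangular (ξ := fun _ => 0) h1,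
    Finset.prod_ite_zero, Finset.prod_ite_zero]
  simp [funext_iff]

/-- An even polynomial has even degree. -/
lemma natDegree_le_of_comp_neg_eq {P : ℂ[X]} {L : ℕ} (hP : P.comp (-X) = P)
    (hL : P.natDegree ≤ L) : P.natDegree ≤ 2 * (L / 2) := by
  rcases Nat.even_or_odd P.natDegree with he | ho
  · obtain ⟨d, hd⟩ := he
    omega
  · exfalso
    have h1 := congrArg (fun p : ℂ[X] => p.coeff P.natDegree) hP
    have e : (-X : ℂ[X]) = C (-1) * X := by simp
    simp only [e, comp_C_mul_X_coeff, ho.neg_one_pow, coeff_natDegree] at h1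
    have h2 : P.leadingCoeff = 0 := by linear_combination (-1 / 2) * h1
    rw [leadingCoeff_eq_zero] at h2
    simp [h2] at ho

/-- The eigenvalue of a left eigenvector, read off from a nonzero component. -/
lemma exists_polynomial_eigenvalue {N L : ℕ} [NeZero N] {ω : ℂ} {h : Fin L → LParam}
    {φ : QSpace N L} {Λ : ℂ → ℂ} (hφ : φ ≠ 0)
    (hΛ : ∀ x, φ ᵥ* normTransfer N L ω h x = Λ x • φ) :
    ∃ P : ℂ[X], (∀ x, P.eval x = Λ x) ∧ P.natDegree ≤ 2 * (L / 2) ∧ P.comp (-X) = P := by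
  obtain ⟨k₀, hk₀⟩ := Function.ne_iff.1 hφ
  rw [Pi.zero_apply] at hk₀
  choose p hp hp' using exists_polynomial_transferMatrix N L ω h
  have hval : ∀ x, Λ x = (φ k₀)⁻¹ * ((∏ j, (h j).d)⁻¹ *
      ∑ k, φ k * transferMatrix N L ω h x k k₀) := fun x => by
    have := congrFun (hΛ x) k₀
    rw [normTransfer, vecMul_smul, Pi.smul_apply, Pi.smul_apply, smul_eq_mul, smul_eq_mul] at this
    rw [eq_inv_mul_iff_mul_eq₀ hk₀, mul_comm, ← this]
    rfl
  have hev : ∀ x, (C ((φ k₀)⁻¹ * (∏ j, (h j).d)⁻¹) * ∑ k, C (φ k) * p k k₀).eval x = Λ x := by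
    intro x
    rw [hval]
    simp [eval_finsetSum, hp', mul_assoc]
  have hcomp : (C ((φ k₀)⁻¹ * (∏ j, (h j).d)⁻¹) * ∑ k, C (φ k) * p k k₀).comp (-X) =
      C ((φ k₀)⁻¹ * (∏ j, (h j).d)⁻¹) * ∑ k, C (φ k) * p k k₀ := by
    refine Polynomial.funext fun x => ?_
    rw [eval_comp, hev, hev, eval_neg, eval_X, hval, hval, transferMatrix_neg]
  refine ⟨_, hev, natDegree_le_of_comp_neg_eq hcomp ?_, hcomp⟩
  refine (natDegree_C_mul_le _ _).trans (natDegree_sum_le_of_forall_le _ _ fun k _ => ?_)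
  exact (natDegree_C_mul_le _ _).trans (hp _ _)

/-! ### Polynomials in the spectral parameter -/

/-- The polynomial `∏_j (1 - c_jᴺ xᴺ)`, whose zeros are the points that are not regular. -/
def polePoly {L : ℕ} (N : ℕ) (cs : Fin L → ℂ) : ℂ[X] :=
  ∏ j, (1 - C (cs j ^ N) * X ^ N)

lemma eval_polePoly {L : ℕ} (N : ℕ) (cs : Fin L → ℂ) (x : ℂ) :
    (polePoly N cs).eval x = ∏ j, (1 - x ^ N * cs j ^ N) := by
  simp [polePoly, eval_prod, mul_comm]

lemma eval_zero_polePoly {L N : ℕ} (hN : N ≠ 0) (cs : Fin L → ℂ) :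
    (polePoly N cs).eval 0 = 1 := by
  simp [eval_polePoly, hN]

lemma eq_of_eval_eq_of_regular {L N : ℕ} (hN : N ≠ 0) {cs : Fin L → ℂ} {p p' : ℂ[X]}
    (hp : ∀ x ∈ regularPoints N cs, p.eval x = p'.eval x) : p = p' := by
  have hR : polePoly N cs ≠ 0 := fun h0 => by
    have := eval_zero_polePoly hN cs
    simp [h0] at this
  have h1 : (p - p') * polePoly N cs = 0 := by
    refine Polynomial.funext fun x => ?_
    rw [eval_mul, eval_sub, eval_zero, mul_eq_zero]
    by_cases hx : x ∈ regularPoints N cs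
    · exact Or.inl (sub_eq_zero.2 (hp x hx))
    · right
      simp only [regularPoints, Set.mem_ofPred_eq, not_forall, not_not] at hx
      obtain ⟨j, hj⟩ := hx
      rw [eval_polePoly]
      exact Finset.prod_eq_zero (Finset.mem_univ j) (by rw [hj, sub_self])
  exact sub_eq_zero.1 ((mul_eq_zero.1 h1).resolve_right hR)

/-- The factors `x ^ m` and `∏_j (1 - c*_jᴺ xᴺ)` are coprime, so they may be treated separately. -/
lemma X_pow_mul_dvd {L N m : ℕ} (hN : N ≠ 0) {Q : ℂ[X]} {cs : Fin L → ℂ} (h1 : X ^ m ∣ Q)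
    (h2 : polePoly N cs ∣ Q) : X ^ m * polePoly N cs ∣ Q := by
  refine IsCoprime.mul_dvd (IsCoprime.pow_left ?_) h1 h2
  rw [Polynomial.irreducible_X.coprime_iff_not_dvd, X_dvd_iff, coeff_zero_eq_eval_zero,
    eval_zero_polePoly hN]
  exact one_ne_zero

/-- The lowest coefficient of a solution of the `TQ` relation determines its order of vanishing
at `0`, up to the symmetry `q ↔ q⁻¹`. -/
lemma exists_order_of_tq {α q : ℂ} {P A B Q : ℂ[X]} (hA : A.eval 0 = 1)
    (hB : B.eval 0 = 1) (hQ : Q ≠ 0)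
    (hTQ : C α * P * Q = A * Q.comp (C q⁻¹ * X) + B * Q.comp (C q * X)) :
    ∃ s : ℕ, X ^ s ∣ Q ∧ α * P.eval 0 = (q ^ s)⁻¹ + q ^ s := by
  obtain ⟨Q', hQ', hQ0⟩ := exists_eq_pow_rootMultiplicity_mul_and_not_dvd Q hQ 0
  generalize rootMultiplicity 0 Q = s at hQ'
  rw [C_0, sub_zero] at hQ' hQ0
  rw [X_dvd_iff, coeff_zero_eq_eval_zero] at hQ0
  refine ⟨s, ⟨Q', hQ'⟩, ?_⟩
  have h1 : X ^ s * (C α * P * Q') = X ^ s * (A * (C (q⁻¹ ^ s) * Q'.comp (C q⁻¹ * X)) +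
      B * (C (q ^ s) * Q'.comp (C q * X))) := by
    rw [hQ'] at hTQ
    simp only [mul_comp, X_pow_comp, mul_pow, ← C_pow] at hTQ
    linear_combination hTQ
  have h2 := congrArg (eval 0) (mul_left_cancel₀ (pow_ne_zero s X_ne_zero) h1)
  simp only [eval_mul, eval_add, eval_C, eval_comp, eval_X, mul_zero, hA, hB, one_mul] at h2
  refine mul_right_cancel₀ hQ0 ?_
  rw [inv_pow] at h2
  linear_combination h2

/-- If `m` is at most half the order of `q`, it is the least exponent `s` with
`q ^ s = q ^ {± m}`. -/
lemma le_of_pow_add_inv_eq {M m s : ℕ} {q : ℂ} (hq : IsPrimitiveRoot q (2 * M + 1)) (hm : m ≤ M)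
    (hs : (q ^ s)⁻¹ + q ^ s = (q ^ m)⁻¹ + q ^ m) : m ≤ s := by
  have hq0 : q ≠ 0 := hq.ne_zero (by omega)
  by_contra! hlt
  have h1 : (q ^ s - q ^ m) * (q ^ s * q ^ m - 1) = 0 := by
    have := pow_ne_zero s hq0
    have := pow_ne_zero m hq0
    field_simp at hs
    linear_combination hs
  rcases mul_eq_zero.1 h1 with h2 | h2
  · have := hq.pow_inj (by omega) (by omega) (sub_eq_zero.1 h2)
    omega
  · rw [← pow_add, sub_eq_zero] at h2
    have := Nat.le_of_dvd (by omega) (hq.dvd_of_pow_eq_one _ h2)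
    omega

/-! ### Left eigenvectors of the transfer matrix -/

lemma twistedSum_add_one {L N : ℕ} [NeZero N] {t : ℂ} (ht : t ^ N = 1) {g : Fin L → ℕ → ℂ}
    (hg : ∀ j, Function.Periodic (g j) N) (k : Fin L → ZMod N) :
    t * twistedSum N t g (fun j => ((k + 1) j).val) = twistedSum N t g fun j => (k j).val := by
  rw [← twistedSum_shift ht hg 1 fun j => (k j).val, pow_one, twistedSum, twistedSum]
  congr 1
  refine Finset.sum_congr rfl fun n _ => ?_
  congr 1
  refine Finset.prod_congr rfl fun j _ => ?_
  have h1 := periodic_val_sub_one (g := fun i => g j (n + 1 + i)) (fun i => by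
    simp only [← add_assoc]; exact hg j _) ((k + 1) j)
  simp only [Pi.add_apply, Pi.one_apply, add_sub_cancel_right] at h1 ⊢
  rw [← h1, ← add_assoc]

namespace Degenerate

variable {L : ℕ} [NeZero L] {M : ℕ} {ω q : ℂ} {h : Fin L → LParam} {r : Fin L → ℂ}

lemma q_primitive (H : Degenerate M ω q h r) : IsPrimitiveRoot q (2 * M + 1) := by
  rw [H.q_eq]
  refine H.root.pow_of_coprime _ ?_
  have e : 2 * M + 1 = (M + 1) + M := by ring
  rw [e, Nat.coprime_self_add_right]
  simp

/-- The entries of a linear form in the basis rescaled by the site weights, in which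
the summand `⊗ (a_j / d_j) Y` of the transfer matrix at `x = 0` is a pure translation. -/
def weighted (q : ℂ) (h : Fin L → LParam) (r : Fin L → ℂ) (φ : QSpace (2 * M + 1) L)
    (k : Fin L → ZMod (2 * M + 1)) : ℂ :=
  φ k * ∏ j, siteWeight q (kappa q h r j) (k j).val

lemma weighted_add_one (H : Degenerate M ω q h r) {φ : QSpace (2 * M + 1) L} {lam : ℂ}
    (hφ : φ ᵥ* normTransfer (2 * M + 1) L ω h 0 = lam • φ) (k : Fin L → ZMod (2 * M + 1)) :
    weighted q h r φ (k + 1) = (lam - 1) * weighted q h r φ k := by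
  have hd : ∏ j, (h j).d ≠ 0 := Finset.prod_ne_zero_iff.2 fun j _ => (H.ne j).2.2.2
  have h1 := congrFun hφ k
  rw [normTransfer, vecMul_smul, Pi.smul_apply, Pi.smul_apply, smul_eq_mul, smul_eq_mul,
    inv_mul_eq_iff_eq_mul₀ hd, vecMul, dotProduct] at h1
  simp only [transferMatrix_zero, mul_add, mul_ite, mul_zero, Finset.sum_add_distrib,
    Finset.sum_ite_eq', Finset.mem_univ, if_true] at h1
  have h2 : ∏ j, siteWeight q (kappa q h r j) ((k + 1) j).val =
      (∏ j, siteWeight q (kappa q h r j) (k j).val) *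
        ((∏ j, (h j).a * ω ^ ((k + 1) j).val) / ∏ j, (h j).d) := by
    rw [← mul_one (_ / ∏ j, (h j).d), ← inv_one, ← H.prod_r_div, ← Finset.prod_inv_distrib,
      ← Finset.prod_div_distrib, ← Finset.prod_mul_distrib, ← Finset.prod_mul_distrib]
    refine Finset.prod_congr rfl fun j _ => ?_
    have hd' := (H.ne j).2.2.2
    have hr0 := H.r_ne_zero j
    have hr1 := H.r_ne_zero (j + 1)
    rw [H.siteWeight_val]
    simp only [Pi.add_apply, Pi.one_apply, add_sub_cancel_right]
    field_simp
  rw [weighted, weighted, h2]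
  field_simp
  linear_combination (∏ j, siteWeight q (kappa q h r j) (k j).val) * h1

/-- The eigenvalue at `0` is determined by the translation operator, whose order is `N`. -/
lemma exists_eigenvalue_zero (H : Degenerate M ω q h r) {φ : QSpace (2 * M + 1) L} {lam : ℂ}
    (hφ0 : φ ≠ 0) (hφ : φ ᵥ* normTransfer (2 * M + 1) L ω h 0 = lam • φ) :
    ∃ l : ℤ, lam = q ^ (2 * l) + 1 := by
  obtain ⟨k, hk⟩ := Function.ne_iff.1 hφ0
  have hk' : weighted q h r φ k ≠ 0 := mul_ne_zero hk <| Finset.prod_ne_zero_iff.2 fun j _ =>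
    mul_ne_zero (pow_ne_zero _ H.q_ne_zero) (pow_ne_zero _ (H.kappa_ne_zero j))
  have h1 : ∀ n : ℕ, weighted q h r φ (k + n) = (lam - 1) ^ n * weighted q h r φ k := by
    intro n
    induction n with
    | zero => simp
    | succ n ih => rw [Nat.cast_succ, ← add_assoc, H.weighted_add_one hφ, ih, pow_succ']; ring
  have h2 := h1 (2 * M + 1)
  have h3 : ((2 * M + 1 : ℕ) : Fin L → ZMod (2 * M + 1)) = 0 := by
    funext j
    rw [Pi.natCast_apply, ZMod.natCast_self, Pi.zero_apply]
  rw [h3, add_zero, eq_comm, mul_eq_right₀ hk'] at h2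
  obtain ⟨i, -, hi⟩ := H.root.eq_pow_of_pow_eq_one h2
  refine ⟨i, ?_⟩
  rw [_root_.zpow_mul, zpow_ofNat, H.q_sq, zpow_natCast, hi, sub_add_cancel]

lemma dotProduct_ketEven (H : Degenerate M ω q h r) {x : ℂ}
    (hx : x ∈ regularPoints (2 * M + 1) (cstar h r)) (l : ℤ) (φ : QSpace (2 * M + 1) L) :
    φ ⬝ᵥ ketEven (2 * M + 1) L ω q h r l x = ∑ k, weighted q h r φ k *
      twistedSum (2 * M + 1) (ω ^ l) (fun j => evenRatio ω (x * cstar h r j))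
        (fun j => (k j).val) := by
  rw [dotProduct]
  refine Finset.sum_congr rfl fun k _ => ?_
  rw [H.ketEven_apply hx, weighted, mul_assoc]

/-- The vectors labelled by `l` are eigenvectors of the translation, with eigenvalue `ω ^ l`. -/
lemma eigenvalue_zero_mul (H : Degenerate M ω q h r) {φ : QSpace (2 * M + 1) L} {lam : ℂ}
    (hφ : φ ᵥ* normTransfer (2 * M + 1) L ω h 0 = lam • φ) {x : ℂ}
    (hx : x ∈ regularPoints (2 * M + 1) (cstar h r)) (l : ℤ) :
    (lam - 1) * (φ ⬝ᵥ ketEven (2 * M + 1) L ω q h r l x) =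
      ω ^ l * (φ ⬝ᵥ ketEven (2 * M + 1) L ω q h r l x) := by
  have step : ∀ k : Fin L → ZMod (2 * M + 1), (lam - 1) * (weighted q h r φ k *
      twistedSum (2 * M + 1) (ω ^ l) (fun j => evenRatio ω (x * cstar h r j))
        (fun j => (k j).val)) = ω ^ l * (weighted q h r φ (k + 1) *
      twistedSum (2 * M + 1) (ω ^ l) (fun j => evenRatio ω (x * cstar h r j))
        (fun j => ((k + 1) j).val)) := fun k => by
    rw [← twistedSum_add_one (H.omega_zpow_pow l) (H.evenRatio_per hx) k,
      H.weighted_add_one hφ]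
    ring
  simp only [H.dotProduct_ketEven hx, Finset.mul_sum, step]
  exact Equiv.sum_comp (Equiv.addRight (1 : Fin L → ZMod (2 * M + 1))) fun k =>
    ω ^ l * (weighted q h r φ k *
      twistedSum (2 * M + 1) (ω ^ l) (fun j => evenRatio ω (x * cstar h r j))
        (fun j => (k j).val))

/-- The function `Q_l^+` is `∏_j (1 - c*_jᴺ xᴺ)` times a linear combination of products over the
sites of polynomials of degree at most `M`. -/
lemma exists_polynomial_dotProduct_ketPlus (H : Degenerate M ω q h r)
    (φ : QSpace (2 * M + 1) L) (l : ℤ) :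
    ∃ Q : ℂ[X], (∀ x ∈ regularPoints (2 * M + 1) (cstar h r),
        Q.eval x = φ ⬝ᵥ ketPlus M L ω q h r l x) ∧
      Q.natDegree ≤ (3 * M + 1) * L ∧ polePoly (2 * M + 1) (cstar h r) ∣ Q := by
  choose p hp hp' using exists_polynomial_evenRatio H.pow_eq_one
  refine ⟨polePoly (2 * M + 1) (cstar h r) * ∑ k : Fin L → ZMod (2 * M + 1),
    C (2 * q ^ (-l) * weighted q h r φ k) * ∑ n ∈ Finset.range (2 * M + 1),
      C ((ω ^ l) ^ n) * ∏ j, (p (n + 1 + (k j).val)).comp (C (cstar h r j) * X), ?_, ?_,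
    dvd_mul_right _ _⟩
  · intro x hx
    rw [H.ketPlus_eq_ketEven hx, dotProduct_smul, smul_eq_mul, H.dotProduct_ketEven hx,
      H.uFun_q_mul, eval_mul, eval_polePoly, eval_finsetSum, Finset.mul_sum, Finset.mul_sum]
    refine Finset.sum_congr rfl fun k _ => ?_
    have h1 : ∀ j m, ((p m).comp (C (cstar h r j) * X)).eval x =
        shiftedFactorial (x * cstar h r j * ω) ω M * evenRatio ω (x * cstar h r j) m :=
      fun j m => by
        rw [eval_comp, eval_mul, eval_C, eval_X, mul_comm, hp' _ _ (H.regular_pow hx j)]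
    simp only [eval_mul, eval_C, eval_finsetSum, eval_prod, h1, Finset.prod_mul_distrib,
      twistedSum, mul_left_comm _ (∏ j, shiftedFactorial (x * cstar h r j * ω) ω M),
      ← Finset.mul_sum]
    ring
  · have e : (3 * M + 1) * L = L * (2 * M + 1) + L * M := by ring
    rw [e]
    refine natDegree_mul_le_of_le ?_ ?_
    · refine (natDegree_prod_le _ _).trans
        ((Finset.sum_le_card_nsmul _ _ (2 * M + 1) fun j _ => ?_).trans (by simp))
      compute_degree
    · refine natDegree_sum_le_of_forall_le _ _ fun k _ => (natDegree_C_mul_le _ _).trans ?_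
      refine natDegree_sum_le_of_forall_le _ _ fun n _ => (natDegree_C_mul_le _ _).trans ?_
      refine (natDegree_prod_le _ _).trans
        ((Finset.sum_le_card_nsmul _ _ M fun j _ => ?_).trans (by simp))
      refine natDegree_comp_le.trans ?_
      calc (p _).natDegree * (C (cstar h r j) * X).natDegree ≤ M * 1 :=
            Nat.mul_le_mul (hp _) (by compute_degree)
        _ = M := mul_one M

/-- The `TQ` relation, obtained from the one for vectors at the infinitely many regular points. -/
lemma tq_relation (H : Degenerate M ω q h r) {φ : QSpace (2 * M + 1) L} {P Q : ℂ[X]}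
    (hP : ∀ x, φ ᵥ* normTransfer (2 * M + 1) L ω h x = P.eval x • φ) (l : ℤ)
    (hQ : ∀ x ∈ regularPoints (2 * M + 1) (cstar h r),
      Q.eval x = φ ⬝ᵥ ketPlus M L ω q h r l x) :
    C (q ^ (-l)) * P * Q = (∏ j, (1 - C (cstar h r j * q⁻¹) * X)) * Q.comp (C q⁻¹ * X) +
      (∏ j, (1 + C (cstar h r j) * X)) * Q.comp (C q * X) := by
  refine eq_of_eval_eq_of_regular (by omega : 2 * M + 1 ≠ 0) (cs := cstar h r) fun x hx => ?_
  have hx1 := H.regular_mul (z := q⁻¹) (by rw [inv_pow, H.q_pow, inv_one]) hx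
  have hx2 := H.regular_mul H.q_pow hx
  have h1 := congrArg (φ ⬝ᵥ ·) (H.normTransfer_mulVec_ketPlus hx l)
  simp only [dotProduct_smul, dotProduct_add, smul_eq_mul, dotProduct_mulVec, hP,
    smul_dotProduct, ← hQ _ hx, ← hQ _ hx1, ← hQ _ hx2] at h1
  have e1 : ∏ j, (1 - cstar h r j * q⁻¹ * x) = deltaMinus q (cstar h r) x (-1) := by
    rw [deltaMinus]
    refine Finset.prod_congr rfl fun j _ => ?_
    rw [_root_.zpow_neg_one]; ring
  have e2 : ∏ j, (1 + cstar h r j * x) = deltaPlus q (cstar h r) x 0 := by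
    rw [H.deltaPlus_zero hx]
    exact Finset.prod_congr rfl fun j _ => by ring
  simp only [eval_add, eval_mul, eval_prod, eval_sub, eval_one, eval_C, eval_X, eval_comp, e1, e2]
  rw [← h1, mul_assoc]

/-- If `l ≡ ± m`, then `Λ(0) = q ^ (2 l) + 1` leaves only orders of vanishing congruent to `± m`. -/
lemma X_pow_dvd (H : Degenerate M ω q h r) {P Q : ℂ[X]} {l : ℤ} {m : ℕ} (hm : m ≤ M)
    (hl : q ^ l = q ^ m ∨ q ^ l = (q ^ m)⁻¹)
    (hTQ : C (q ^ (-l)) * P * Q = (∏ j, (1 - C (cstar h r j * q⁻¹) * X)) * Q.comp (C q⁻¹ * X) +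
      (∏ j, (1 + C (cstar h r j) * X)) * Q.comp (C q * X))
    (hP : Q ≠ 0 → P.eval 0 = q ^ (2 * l) + 1) : X ^ m ∣ Q := by
  by_cases hQ : Q = 0
  · rw [hQ]; exact dvd_zero _
  obtain ⟨s, hs, hs'⟩ := exists_order_of_tq (by simp [eval_prod]) (by simp [eval_prod]) hQ hTQ
  have hq0 := H.q_ne_zero
  refine (pow_dvd_pow X (le_of_pow_add_inv_eq H.q_primitive hm ?_)).trans hs
  have e : q ^ (-l) * (q ^ (2 * l) + 1) = q ^ l + (q ^ l)⁻¹ := by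
    rw [two_mul, zpow_add₀ hq0, _root_.zpow_neg]
    have := zpow_ne_zero l hq0
    field_simp
  rw [← hs', hP hQ, e]
  rcases hl with hl | hl <;> rw [hl]
  · ring
  · rw [inv_inv]

end Degenerate

end BaxterTQ

end

theorem theorem1 (M L : ℕ) [NeZero L] (hM : 1 ≤ M)
    (ω : ℂ) (hω : IsPrimitiveRoot ω (2 * M + 1)) (q : ℂ) (hq : q = ω ^ (M + 1))
    (h : Fin L → BaxterTQ.LParam)
    (hne : ∀ j, (h j).a ≠ 0 ∧ (h j).b ≠ 0 ∧ (h j).c ≠ 0 ∧ (h j).d ≠ 0)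
    (r : Fin L → ℂ)
    (hr : ∀ j, r (j + 1) ^ 2 = ((h j).b * (h j).d) / ((h j).a * (h j).c))
    (hcurve : ∀ (x : ℂ) (l : ℤ),
      (x, BaxterTQ.sheet q r l) ∈ BaxterTQ.spectralCurve (2 * M + 1) L h) :
    -- components of the Baxter vacuum state `|x, l⟩`
    (∀ x ∈ BaxterTQ.regularPoints (2 * M + 1) (BaxterTQ.cstar h r), ∀ (l : ℤ)
        (k : Fin L → ZMod (2 * M + 1)),
      BaxterTQ.vac (2 * M + 1) L ω q h r l x k =
        q ^ (∑ j, (k j).val ^ 2) *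
          ∏ j, (q * (h j).a * r (j + 1) / ((h j).d * r j)) ^ (k j).val *
            (BaxterTQ.shiftedFactorial (x * BaxterTQ.cstar h r j * q ^ (-l - 2)) ω⁻¹ (k j).val /
              BaxterTQ.shiftedFactorial (x * BaxterTQ.cstar h r j * q ^ (l + 2)) ω (k j).val)) ∧
    -- (i)
    (∀ x ∈ BaxterTQ.regularPoints (2 * M + 1) (BaxterTQ.cstar h r), ∀ l : ℤ,
      BaxterTQ.uFun M q (BaxterTQ.cstar h r) (q * x) •
          BaxterTQ.ketEven (2 * M + 1) L ω q h r l x =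
        (q ^ l * BaxterTQ.uFun M q (BaxterTQ.cstar h r) x) •
          BaxterTQ.ketOdd (2 * M + 1) L ω q h r l x ∧
      BaxterTQ.ketPlus M L ω q h r l x =
        (2 * q ^ (-l) * BaxterTQ.uFun M q (BaxterTQ.cstar h r) (q * x)) •
          BaxterTQ.ketEven (2 * M + 1) L ω q h r l x ∧
      BaxterTQ.ketPlus M L ω q h r l x =
        (2 * BaxterTQ.uFun M q (BaxterTQ.cstar h r) x) •
          BaxterTQ.ketOdd (2 * M + 1) L ω q h r l x) ∧
    -- (ii)
    (∀ x ∈ BaxterTQ.regularPoints (2 * M + 1) (BaxterTQ.cstar h r), ∀ l : ℤ,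
      q ^ (-l) • (BaxterTQ.normTransfer (2 * M + 1) L ω h x *ᵥ BaxterTQ.ketPlus M L ω q h r l x) =
        BaxterTQ.deltaMinus q (BaxterTQ.cstar h r) x (-1) •
            BaxterTQ.ketPlus M L ω q h r l (q⁻¹ * x) +
          BaxterTQ.deltaPlus q (BaxterTQ.cstar h r) x 0 •
            BaxterTQ.ketPlus M L ω q h r l (q * x)) ∧
    -- (iii)
    (∀ (φ : BaxterTQ.QSpace (2 * M + 1) L) (Λ : ℂ → ℂ), φ ≠ 0 →
      (∀ x, φ ᵥ* BaxterTQ.normTransfer (2 * M + 1) L ω h x = Λ x • φ) →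
      ∃ (P : ℂ[X]) (Q : ℤ → ℂ[X]),
        (∀ x, P.eval x = Λ x) ∧
        (∀ l : ℤ, ∀ x ∈ BaxterTQ.regularPoints (2 * M + 1) (BaxterTQ.cstar h r),
          (Q l).eval x = φ ⬝ᵥ BaxterTQ.ketPlus M L ω q h r l x) ∧
        (∀ l : ℤ, (Q l).natDegree ≤ (3 * M + 1) * L) ∧
        P.natDegree ≤ 2 * (L / 2) ∧
        P.comp (-X) = P ∧
        (∃ l : ℤ, P.eval 0 = q ^ (2 * l) + 1) ∧
        (∀ l : ℤ, Q l ≠ 0 → P.eval 0 = q ^ (2 * l) + 1) ∧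
        (∀ l : ℤ, C (q ^ (-l)) * P * Q l =
          (∏ j, (1 - C (BaxterTQ.cstar h r j * q⁻¹) * X)) * (Q l).comp (C q⁻¹ * X) +
            (∏ j, (1 + C (BaxterTQ.cstar h r j) * X)) * (Q l).comp (C q * X)) ∧
        (∀ m : ℕ, m ≤ M →
          (X ^ m * ∏ j, (1 - C (BaxterTQ.cstar h r j ^ (2 * M + 1)) * X ^ (2 * M + 1))) ∣
              Q (m : ℤ) ∧
          (X ^ m * ∏ j, (1 - C (BaxterTQ.cstar h r j ^ (2 * M + 1)) * X ^ (2 * M + 1))) ∣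
              Q (((2 * M + 1 : ℕ) : ℤ) - (m : ℤ)))) := by
  -- the fibre of the curve over `x = 0`
  have hfib : ∀ j, (r j * (h j).d) ^ (2 * M + 1) = (r (j + 1) * (h j).a) ^ (2 * M + 1) := by
    intro j
    have h1 := hcurve 0 0 j
    have hodd : (-1 : ℂ) ^ (2 * M + 1) = -1 := Odd.neg_one_pow ⟨M, rfl⟩
    simp only [BaxterTQ.sheet, zpow_zero, mul_one, hodd, zero_pow (Nat.succ_ne_zero (2 * M)),
      mul_zero, zero_mul, zero_sub, sub_zero] at h1
    rw [mul_pow, mul_pow]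
    linear_combination -h1
  have H : BaxterTQ.Degenerate M ω q h r := ⟨hω, hq, hne, hr, hfib⟩
  refine ⟨fun x hx l k => ?_, fun x hx l => ⟨H.ketEven_eq_ketOdd hx l, H.ketPlus_eq_ketEven hx l,
    H.ketPlus_eq_ketOdd hx l⟩, fun x hx l => H.normTransfer_mulVec_ketPlus hx l,
    fun φ Λ hφ hΛ => ?_⟩
  · rw [H.vac_apply hx, ← Finset.prod_pow_eq_pow_sum, ← Finset.prod_mul_distrib,
      ← Finset.prod_mul_distrib]
    exact Finset.prod_congr rfl fun j _ => by
      rw [BaxterTQ.siteWeight, BaxterTQ.kappa, mul_assoc]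
  · obtain ⟨P, hP, hPdeg, hPneg⟩ := BaxterTQ.exists_polynomial_eigenvalue hφ hΛ
    choose Q hQ hQdeg hQdvd using H.exists_polynomial_dotProduct_ketPlus φ
    have hTQ := fun l => H.tq_relation (fun x => (hP x).symm ▸ hΛ x) l (hQ l)
    have hΛ0 : φ ᵥ* BaxterTQ.normTransfer (2 * M + 1) L ω h 0 = P.eval 0 • φ :=
      (hP 0).symm ▸ hΛ 0
    have hzero : ∀ l : ℤ, Q l ≠ 0 → P.eval 0 = q ^ (2 * l) + 1 := by
      intro l hl
      by_contra hne0
      refine hl (BaxterTQ.eq_of_eval_eq_of_regular (by omega : 2 * M + 1 ≠ 0)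
        (cs := BaxterTQ.cstar h r) fun x hx => ?_)
      have h1 := H.eigenvalue_zero_mul hΛ0 hx l
      rw [← sub_eq_zero, ← sub_mul, mul_eq_zero] at h1
      rw [hQ l x hx, H.ketPlus_eq_ketEven hx, dotProduct_smul, h1.resolve_left, smul_zero,
        eval_zero]
      intro h2
      apply hne0
      rw [_root_.zpow_mul, zpow_ofNat, H.q_sq]
      linear_combination h2
    refine ⟨P, Q, hP, hQ, hQdeg, hPdeg, hPneg, H.exists_eigenvalue_zero hφ hΛ0, hzero, hTQ,
      fun m hm => ⟨?_, ?_⟩⟩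
    · refine BaxterTQ.X_pow_mul_dvd (by omega) (H.X_pow_dvd hm (Or.inl ?_) (hTQ _) (hzero _))
        (hQdvd _)
      exact zpow_natCast _ _
    · refine BaxterTQ.X_pow_mul_dvd (by omega) (H.X_pow_dvd hm (Or.inr ?_) (hTQ _) (hzero _))
        (hQdvd _)
      rw [zpow_sub₀ H.q_ne_zero, zpow_natCast, zpow_natCast, H.q_pow, one_div]
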